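/- A \emph{planar map} is an embedding of a finite, nonempty, connected graph (multiple edges and loops allowed) in the Riemann sphere: vertices are distinct points, edges are continuous arcs that meet only at vertices (such an embedding is automatically cellular: all its faces are simply connected). Its \emph{faces} are the connected components of the complement of the embedded graph. A \emph{submap} of $G$ is a planar map obtained from $G$ by erasing some vertices and edges. A \emph{bipartite map} is a planar map with at least two vertices, each coloured black or white, such that every edge has one black and one white tip. For a bipartite map or a submap $H$ of it, let $V_H$ and $F_H$ be the numbers of black vertices and of faces of $H$, let $\mathcal{W}_H$ be the set of its white vertices, and let $\deg_H(w)$ be the number of edges of $H$ incident to $w$. A bipartite map $G$ is \emph{globally balanced} if $F_G = V_G$; it is \emph{locally balanced} if $F_H \le V_H$ for every submap $H$ of $G$ that contains at least one black vertex; it is \emph{balanced} if it is both. Theorem. Let $G$ be a bipartite map. Then $G$ is globally balanced if and only if $$\sum_{w\in \mathcal{W}_G}\bigl(\deg_G(w)-1\bigr) = 2V_G-2,$$ and $G$ is locally balanced if and only if, for every submap $H$ of $G$ that contains at least one black vertex, $$\sum_{w\in \mathcal{W}_H}\bigl(\deg_H(w)-1\bigr) \le 2V_H-2 .$$ Consequently,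 if $G$ and $G'$ are bipartite maps whose underlying graphs are isomorphic by an isomorphism that preserves the colours of the vertices, then $G$ is globally balanced (resp. locally balanced, resp. balanced) if and only if $G'$ is. -/

import Mathlib

open scoped unitInterval

/-- A graph on the vertex set `V` with edge set `E` (both finite in all uses): each edge has a pair
of tips (loops and multiple edges are allowed, the order of the two tips is immaterial), and each
vertex is either black or white (white means: not black). -/
structure ColoredGraph (V E : Type*) where
  tips : E → V × V
  IsBlack : V → Prop

namespace ColoredGraph

variable {V E V' E' : Type*}

/-- Every edge has a black tip and a white tip. -/
def IsProperlyColored (G : ColoredGraph V E) : Prop :=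
  ∀ e, G.IsBlack (G.tips e).1 ↔ ¬ G.IsBlack (G.tips e).2

/-- The graph is nonempty and any two vertices are joined by a path of edges. -/
def Connected (G : ColoredGraph V E) : Prop :=
  (SimpleGraph.fromRel fun u v : V => ∃ e, G.tips e = (u, v)).Connected

open Classical in
/-- The set of black vertices. -/
noncomputable def blackVertices [Fintype V] (G : ColoredGraph V E) : Finset V :=
  {v | G.IsBlack v}

open Classical in
/-- The set of white vertices. -/
noncomputable def whiteVertices [Fintype V] (G : ColoredGraph V E) : Finset V :=
  {v | ¬ G.IsBlack v}

open Classical in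
/-- The number of edges incident to `v`, loops being counted twice. -/
noncomputable def degree [Fintype E] (G : ColoredGraph V E) (v : V) : ℕ :=
  Finset.card {e : E | (G.tips e).1 = v} + Finset.card {e : E | (G.tips e).2 = v}

/-- An isomorphism of graphs that preserves the colours; tips are compared as unordered pairs. -/
structure Iso (G : ColoredGraph V E) (G' : ColoredGraph V' E') where
  onVertices : V ≃ V'
  onEdges : E ≃ E'
  tips_eq : ∀ e, s((G'.tips (onEdges e)).1, (G'.tips (onEdges e)).2) =
    s(onVertices (G.tips e).1, onVertices (G.tips e).2)
  isBlack_iff : ∀ v, G'.IsBlack (onVertices v) ↔ G.IsBlack v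

end ColoredGraph

/-- A coloured graph embedded in the Riemann sphere: the vertices are distinct points, each edge is
a continuous arc joining its two tips, and arcs meet each other, themselves and the vertices only
at their tips. -/
structure SphereGraph (V E : Type*) extends ColoredGraph V E where
  point : V → OnePoint ℂ
  point_injective : Function.Injective point
  arc : E → C(I, OnePoint ℂ)
  arc_zero : ∀ e, arc e 0 = point (tips e).1
  arc_one : ∀ e, arc e 1 = point (tips e).2
  arc_injOn : ∀ e, Set.InjOn (arc e) (Set.Ioo 0 1)
  arc_ne_point : ∀ e, ∀ t ∈ Set.Ioo (0 : I) 1, ∀ v, arc e t ≠ point v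
  arc_disjoint : ∀ e e', e ≠ e' → Disjoint (arc e '' Set.Ioo 0 1) (arc e' '' Set.Ioo 0 1)

namespace SphereGraph

variable {V E : Type*}

/-- The union of all the vertices and edges, as a subset of the sphere. -/
def support (G : SphereGraph V E) : Set (OnePoint ℂ) :=
  Set.range G.point ∪ ⋃ e, Set.range (G.arc e)

/-- The faces: the connected components of the complement of the embedded graph. -/
def faces (G : SphereGraph V E) : Set (Set (OnePoint ℂ)) :=
  {f | ∃ x ∈ G.supportᶜ, f = connectedComponentIn G.supportᶜ x}

/-- A planar map is an embedding of a nonempty connected (finite) graph in the sphere. -/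
def IsPlanarMap (G : SphereGraph V E) : Prop := G.toColoredGraph.Connected

/-- A bipartite map is a planar map with at least two vertices, all of whose edges have a black and
a white tip. -/
def IsBipartiteMap (G : SphereGraph V E) : Prop :=
  G.IsPlanarMap ∧ Nontrivial V ∧ G.toColoredGraph.IsProperlyColored

/-- The embedded graph with vertex set `S` and edge set `T` obtained by erasing from `G` all the
other vertices and edges, where all the tips of the edges in `T` belong to `S`. -/
def erase (G : SphereGraph V E) (S : Finset V) (T : Finset E)
    (h : ∀ e ∈ T, (G.tips e).1 ∈ S ∧ (G.tips e).2 ∈ S) : SphereGraph S T where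
  tips e := (⟨(G.tips e).1, (h e e.2).1⟩, ⟨(G.tips e).2, (h e e.2).2⟩)
  IsBlack v := G.IsBlack v
  point v := G.point v
  point_injective := G.point_injective.comp Subtype.val_injective
  arc e := G.arc e
  arc_zero e := G.arc_zero e
  arc_one e := G.arc_one e
  arc_injOn e := G.arc_injOn e
  arc_ne_point e t ht v := G.arc_ne_point e t ht v
  arc_disjoint e e' hne := G.arc_disjoint e e' fun h' => hne (Subtype.ext h')

/-- A submap of `G`: a planar map obtained from `G` by erasing some vertices and edges. -/
structure Submap (G : SphereGraph V E) where
  verts : Finset V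
  edges : Finset E
  tips_mem : ∀ e ∈ edges, (G.tips e).1 ∈ verts ∧ (G.tips e).2 ∈ verts
  isPlanarMap : (G.erase verts edges tips_mem).IsPlanarMap

/-- A submap as an embedded graph in its own right. -/
def Submap.toSphereGraph {G : SphereGraph V E} (H : G.Submap) : SphereGraph H.verts H.edges :=
  G.erase H.verts H.edges H.tips_mem

/-- As many faces as black vertices. -/
def IsGloballyBalanced [Fintype V] (G : SphereGraph V E) : Prop :=
  G.faces.encard = G.blackVertices.card

/-- Each submap containing a black vertex has at least as many black vertices as faces. -/
def IsLocallyBalanced (G : SphereGraph V E) : Prop :=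
  ∀ H : G.Submap, (∃ v ∈ H.verts, G.IsBlack v) →
    H.toSphereGraph.faces.encard ≤ H.toSphereGraph.blackVertices.card

/-- Globally and locally balanced. -/
def IsBalanced [Fintype V] (G : SphereGraph V E) : Prop :=
  G.IsGloballyBalanced ∧ G.IsLocallyBalanced

end SphereGraph

open Set Topology Filter

/-! In a properly coloured connected graph with `V` vertices, `B` of them black, and `E` edges, each
edge has exactly one white tip, so the white vertices contribute `E - (V - B)` to the sum of `deg(w)
- 1`. Euler's formula `F + V = E + 2` turns this into `F - 2 + B`, so comparing `F` with `B` amounts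
to comparing the sum with `2B - 2`. This applies to the map and to each of its submaps. Euler's
formula also shows that `F` depends only on the abstract graph, whence the invariance under
isomorphism.

The work lies in Euler's formula for arbitrary continuous arcs, `SphereGraph.encard_faces_add_card`.
The embedded graph misses a point of the sphere; that point is moved to infinity and the resulting
plane drawing is built edge by edge. A pendant edge creates no face, and an edge with both ends on
the connected drawing creates exactly one. These facts, a form of the Jordan curve theorem, rest on
Eilenberg's criterion: separation of `a` from `b` by a compact set `K` is detected by continuous
logarithms of `(z - a) / (z - b)` on `K` (`hasLogOn_sub_div_sub`, `eq_zero_of_hasLogOn_frontier`).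
Gluing logarithms along the ends of an arc gives the upper bounds on the number of new components;
`not_isPreconnected_diff_arc` gives the lower bound. -/

/-- The function `f` has a continuous logarithm on `K`. -/
def HasLogOn {X : Type*} [TopologicalSpace X] (f : X → ℂ) (K : Set X) : Prop :=
  ∃ g : X → ℂ, ContinuousOn g K ∧ ∀ z ∈ K, f z = Complex.exp (g z)

/-! ### Continuous logarithms: constructions and gluing. -/

namespace HasLogOn

variable {X : Type*} [TopologicalSpace X] {f f' : X → ℂ} {K K' : Set X}

theorem mono (h : HasLogOn f K) (hK : K' ⊆ K) : HasLogOn f K' :=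
  let ⟨g, hg, e⟩ := h
  ⟨g, hg.mono hK, fun z hz => e z (hK hz)⟩

theorem congr (h : HasLogOn f K) (e : ∀ z ∈ K, f' z = f z) : HasLogOn f' K :=
  let ⟨g, hg, e'⟩ := h
  ⟨g, hg, fun z hz => (e z hz).trans (e' z hz)⟩

theorem mul (h : HasLogOn f K) (h' : HasLogOn f' K) : HasLogOn (fun z => f z * f' z) K :=
  let ⟨g, hg, e⟩ := h
  let ⟨g', hg', e'⟩ := h'
  ⟨fun z => g z + g' z, hg.add hg', fun z hz => by simp only [Complex.exp_add, e z hz, e' z hz]⟩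

theorem inv (h : HasLogOn f K) : HasLogOn (fun z => (f z)⁻¹) K :=
  let ⟨g, hg, e⟩ := h
  ⟨fun z => - g z, hg.neg, fun z hz => by simp only [Complex.exp_neg, e z hz]⟩

/-- The open unit disc around `1` lies in the slit plane, where the principal branch is continuous.
-/
theorem of_norm_sub_one_lt (hf : ContinuousOn f K) (h : ∀ z ∈ K, ‖f z - 1‖ < 1) :
    HasLogOn f K := by
  refine ⟨fun z => Complex.log (f z), hf.clog fun z hz => ?_, fun z hz => ?_⟩
  · have := Complex.mem_slitPlane_of_norm_lt_one (h z hz)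
    simpa using this
  · rw [Complex.exp_log]
    intro h0
    simpa [h0] using h z hz

/-- Continuous nonvanishing functions on a simply connected, locally path connected space have
logarithms. -/
theorem of_simplyConnected {A : Type*} [TopologicalSpace A] [SimplyConnectedSpace A]
    [LocallyPathConnectedSpace A] {F : A → ℂ} (hF : Continuous F) (h0 : ∀ a, F a ≠ 0) :
    HasLogOn F univ := by
  obtain ⟨a₀⟩ : Nonempty A := inferInstance
  obtain ⟨G, ⟨-, hG⟩, -⟩ := Complex.isCoveringMapOn_exp.existsUnique_continuousMap_lifts
    (A := A) ⟨F, hF⟩ (a₀ := a₀) (e₀ := Complex.log (F a₀)) (Complex.exp_log (h0 a₀)) h0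
  exact ⟨G, G.continuous.continuousOn, fun z _ => (congrFun hG z).symm⟩

/-- Continuous nonvanishing functions on an arc have logarithms. -/
theorem of_range_arc {γ : I → X} (hγ : IsEmbedding γ) (hf : ContinuousOn f (range γ))
    (h0 : ∀ z ∈ range γ, f z ≠ 0) : HasLogOn f (range γ) := by
  -- The arc is extended to the real line by constants, and the logarithm found there is carried
  -- back along the inverse of `γ`.
  obtain ⟨g, hg, e⟩ := of_simplyConnected (A := ℝ)
    (F := fun t => f (γ (projIcc 0 1 zero_le_one t)))
    (hf.comp_continuous (hγ.continuous.comp continuous_projIcc) fun t => mem_range_self _)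
    (fun t => h0 _ (mem_range_self _))
  rw [continuousOn_univ] at hg
  have : Nonempty I := ⟨0⟩
  refine ⟨fun x => g (Function.invFun γ x : I), ?_, ?_⟩
  · rw [continuousOn_iff_continuous_domRestrict]
    rw [← hγ.toHomeomorph.comp_continuous_iff']
    refine (hg.comp continuous_subtype_val).congr fun t => ?_
    simp [Function.leftInverse_invFun hγ.injective t]
  · rintro _ ⟨t, rfl⟩
    simpa [Function.leftInverse_invFun hγ.injective t] using e t trivial

end HasLogOn

/-- Two logarithms of a function on a preconnected set differ by a constant multiple
of `2πi`. -/
theorem exists_int_of_exp_eq_exp {X : Type*} [TopologicalSpace X] {g g' : X → ℂ} {K : Set X}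
    (hK : IsPreconnected K) (hg : ContinuousOn g K) (hg' : ContinuousOn g' K)
    (h : ∀ z ∈ K, Complex.exp (g z) = Complex.exp (g' z)) :
    ∃ n : ℤ, ∀ z ∈ K, g z = g' z + n * (2 * Real.pi * Complex.I) := by
  have hd : IsDiscrete (AddSubgroup.zmultiples (2 * Real.pi * Complex.I : ℂ) : Set ℂ) :=
    ⟨NormedSpace.discreteTopology_zmultiples _⟩
  obtain ⟨y, ⟨n, rfl⟩, hy⟩ := hK.eqOn_const_of_mapsTo hd (f := fun z => g z - g' z) (hg.sub hg')
    (fun z hz => by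
      obtain ⟨n, hn⟩ := Complex.exp_eq_exp_iff_exists_int.1 (h z hz)
      exact ⟨n, by simp [hn]⟩) ⟨0, zero_mem _⟩
  refine ⟨n, fun z hz => ?_⟩
  have := hy hz
  simp only [Function.const_apply, zsmul_eq_mul] at this
  rw [← this]; ring

/-- Gluing of two logarithms that agree on the intersection of two closed sets. -/
theorem HasLogOn.union {X : Type*} [TopologicalSpace X] {f g g' : X → ℂ} {K K' : Set X}
    (hK : IsClosed K) (hK' : IsClosed K') (hg : ContinuousOn g K) (hg' : ContinuousOn g' K')
    (e : ∀ z ∈ K, f z = Complex.exp (g z)) (e' : ∀ z ∈ K', f z = Complex.exp (g' z))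
    (h : ∀ z ∈ K ∩ K', g z = g' z) : HasLogOn f (K ∪ K') := by
  classical
  have h1 : EqOn (K.piecewise g g') g K := piecewise_eqOn _ _ _
  have h2 : EqOn (K.piecewise g g') g' K' := fun z hz => by
    by_cases hzK : z ∈ K
    · simp [hzK, h z ⟨hzK, hz⟩]
    · simp [hzK]
  refine ⟨K.piecewise g g', (hg.congr h1).union_of_isClosed (hg'.congr h2) hK hK', ?_⟩
  rintro z (hz | hz)
  · rw [h1 hz, e z hz]
  · rw [h2 hz, e' z hz]

/-- Functions with logarithms on two closed sets with a preconnected intersection have logarithms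
on the union. -/
theorem HasLogOn.union_of_isPreconnected {X : Type*} [TopologicalSpace X] {f : X → ℂ}
    {K K' : Set X} (hK : IsClosed K) (hK' : IsClosed K') (hi : IsPreconnected (K ∩ K'))
    (h : HasLogOn f K) (h' : HasLogOn f K') : HasLogOn f (K ∪ K') := by
  obtain ⟨g, hg, e⟩ := h
  obtain ⟨g', hg', e'⟩ := h'
  obtain ⟨n, hn⟩ := exists_int_of_exp_eq_exp hi (hg.mono inter_subset_left)
    (hg'.mono inter_subset_right) fun z hz => (e z hz.1).symm.trans (e' z hz.2)
  refine HasLogOn.union (g := g) (g' := fun z => g' z + n * (2 * Real.pi * Complex.I)) hK hK' hg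
    (hg'.add continuousOn_const) e (fun z hz => ?_) hn
  rw [e' z hz, Complex.exp_add, Complex.exp_int_mul_two_pi_mul_I, mul_one]

/-! ### Logarithms and components of plane complements. -/

/-- If `a` and `b` are joined by a connected set that avoids the compact set `K`, then
`(z - a) / (z - b)` has a logarithm on `K`. -/
theorem hasLogOn_sub_div_sub {K C : Set ℂ} (hK : IsCompact K) (hC : IsPreconnected C)
    (hKC : Disjoint K C) {a b : ℂ} (ha : a ∈ C) (hb : b ∈ C) :
    HasLogOn (fun z => (z - a) / (z - b)) K := by
  have hne : ∀ c ∈ C, ∀ z ∈ K, z - c ≠ 0 := fun c hc z hz h =>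
    hKC.ne_of_mem hz hc (sub_eq_zero.1 h)
  -- The relation between `a` and `b` is symmetric and transitive, so on a connected set it need
  -- only be checked for nearby points.
  refine hC.induction₂ (fun a b => HasLogOn (fun z => (z - a) / (z - b)) K) ?_ ?_ ?_ ha hb
  · intro x hx
    have hxK : Kᶜ ∈ 𝓝 x := hK.isClosed.isOpen_compl.mem_nhds fun h => hKC.ne_of_mem h hx rfl
    obtain ⟨ε, hε, hball⟩ := Metric.mem_nhds_iff.1 hxK
    filter_upwards [mem_nhdsWithin_of_mem_nhds (Metric.ball_mem_nhds x hε), self_mem_nhdsWithin]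
      with y hy hyC
    have : HasLogOn (fun z => (z - y) / (z - x)) K := by
      refine .of_norm_sub_one_lt ?_ fun z hz => ?_
      · exact ContinuousOn.div (by fun_prop) (by fun_prop) (hne x hx)
      · have h1 : (z - y) / (z - x) - 1 = (x - y) / (z - x) := by
          rw [div_sub_one (hne x hx z hz)]; ring
        have h2 : ε ≤ ‖z - x‖ := by
          by_contra! h
          exact hball (mem_ball_iff_norm.2 h) hz
        rw [h1, norm_div, div_lt_one (hε.trans_le h2), norm_sub_rev]
        exact (mem_ball_iff_norm.1 hy).trans_le h2
    exact this.inv.congr fun z _ => (inv_div _ _).symm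
  · intro x y w _ hy _ h1 h2
    exact (h1.mul h2).congr fun z hz => by
      rw [div_mul_div_cancel₀ (hne y hy z hz)]
  · intro x y _ _ h
    exact h.inv.congr fun z _ => (inv_div _ _).symm

/-- No nonzero power of `z - a` has a logarithm on a circle around `a`. -/
theorem eq_zero_of_hasLogOn_sphere {a : ℂ} {r : ℝ} (hr : 0 < r) {k : ℤ}
    (h : HasLogOn (fun z => (z - a) ^ k) (Metric.sphere a r)) : k = 0 := by
  obtain ⟨g, hg, e⟩ := h
  have hmem : ∀ θ : ℝ, circleMap a r θ ∈ Metric.sphere a r := circleMap_mem_sphere a hr.le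
  have hexp : ∀ θ : ℝ, Complex.exp (g (circleMap a r θ)) =
      Complex.exp (k * (Real.log r + θ * Complex.I)) := fun θ => by
    rw [← e _ (hmem θ), Complex.exp_int_mul, Complex.exp_add, ← Complex.ofReal_exp,
      Real.exp_log hr]
    simp [circleMap]
  obtain ⟨n, hn⟩ := exists_int_of_exp_eq_exp isPreconnected_univ
    (hg.comp_continuous (continuous_circleMap a r) hmem).continuousOn
    (by fun_prop) fun θ _ => hexp θ
  -- The angles `0` and `2π` give the same point of the circle, while the explicit logarithm grows
  -- by `2πik`.
  have h0 := hn 0 trivial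
  have h1 := hn (2 * Real.pi) trivial
  simp only [Function.comp] at h0 h1
  have h2 : circleMap a r (2 * Real.pi) = circleMap a r 0 := by
    simpa using periodic_circleMap a r 0
  rw [h2, h0] at h1
  have h3 : (k : ℂ) * (2 * Real.pi * Complex.I) = 0 := by
    push_cast at h1
    linear_combination -h1
  simpa [Real.pi_ne_zero] using h3

/-- If `Ω` is a bounded set containing `a` and `(z - a) ^ k * h z` has a logarithm on the frontier
of `Ω`, where `h` does not vanish on `Ω`, then `k = 0`. -/
theorem eq_zero_of_hasLogOn_frontier {Ω : Set ℂ} (hΩ : Bornology.IsBounded Ω) {a : ℂ}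
    (ha : a ∈ interior Ω) {h : ℂ → ℂ} (hc : ContinuousOn h (closure Ω))
    (h0 : ∀ z ∈ closure Ω, h z ≠ 0) {k : ℤ}
    (hlog : HasLogOn (fun z => (z - a) ^ k * h z) (frontier Ω)) : k = 0 := by
  classical
  obtain ⟨g, hg, e⟩ := hlog
  -- Tietze extension of the logarithm. Then `exp G / h` on the closure of `Ω` and `(z - a) ^ k` off
  -- its interior glue to a nonvanishing function on the whole plane, which has a logarithm; on a
  -- circle enclosing `Ω` it equals `(z - a) ^ k`.
  obtain ⟨G, hG⟩ := ContinuousMap.exists_restrict_eq isClosed_frontier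
    ⟨(frontier Ω).domRestrict g, hg.domRestrict⟩
  have hGg : ∀ z ∈ frontier Ω, G z = g z := fun z hz => congrArg (fun u => u ⟨z, hz⟩) hG
  have hne : ∀ z ∉ interior Ω, z - a ≠ 0 := fun z hz h => hz (sub_eq_zero.1 h ▸ ha)
  set F : ℂ → ℂ := (closure Ω).piecewise (fun z => Complex.exp (G z) / h z)
    (fun z => (z - a) ^ k) with hF
  have hFin : EqOn F (fun z => Complex.exp (G z) / h z) (closure Ω) := piecewise_eqOn _ _ _
  have hFout : EqOn F (fun z => (z - a) ^ k) (interior Ω)ᶜ := fun z hz => by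
    by_cases hzc : z ∈ closure Ω
    · have hzf : z ∈ frontier Ω := ⟨hzc, hz⟩
      rw [hFin hzc]
      simp only
      rw [hGg z hzf, ← e z hzf, mul_div_cancel_right₀ _ (h0 z hzc)]
    · simp [hF, hzc]
  have hcont : Continuous F := by
    rw [← continuousOn_univ, ← union_compl_self (closure Ω)]
    have hsub : closure Ω ∪ (interior Ω)ᶜ = closure Ω ∪ (closure Ω)ᶜ := by
      rw [union_compl_self]
      refine eq_univ_of_forall fun z => ?_
      by_cases hz : z ∈ interior Ω
      · exact .inl (subset_closure (interior_subset hz))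
      · exact .inr hz
    rw [← hsub]
    refine ContinuousOn.union_of_isClosed ?_ ?_ isClosed_closure isOpen_interior.isClosed_compl
    · refine ContinuousOn.congr ?_ hFin
      exact ContinuousOn.div (by fun_prop) hc h0
    · refine ContinuousOn.congr ?_ hFout
      exact ContinuousOn.zpow₀ (by fun_prop) _ fun z hz => .inl (hne z hz)
  have hF0 : ∀ z, F z ≠ 0 := fun z => by
    by_cases hz : z ∈ closure Ω
    · rw [hFin hz]
      exact div_ne_zero (Complex.exp_ne_zero _) (h0 z hz)
    · have hz' : z ∈ (interior Ω)ᶜ := fun h => hz (subset_closure (interior_subset h))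
      rw [hFout hz']
      exact zpow_ne_zero _ (hne z hz')
  have hFlog := HasLogOn.of_simplyConnected hcont hF0
  obtain ⟨R, hR⟩ := (Metric.isBounded_iff_subset_ball a).1 hΩ
  have hR0 : 0 < max R 1 := by positivity
  refine eq_zero_of_hasLogOn_sphere (a := a) hR0 ((hFlog.mono (subset_univ _)).congr fun z hz => ?_)
  refine (hFout fun hzi => ?_).symm
  have h1 := hR (interior_subset hzi)
  rw [Metric.mem_ball] at h1
  rw [Metric.mem_sphere] at hz
  have := le_max_left R 1
  linarith

/-- A frontier point in `U` would have its own open component, which meets the given one and hence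
equals it. -/
theorem frontier_connectedComponentIn_subset {X : Type*} [TopologicalSpace X]
    [LocallyConnectedSpace X] {U : Set X} (hU : IsOpen U) (x : X) :
    frontier (connectedComponentIn U x) ⊆ Uᶜ := by
  intro y hy hyU
  rw [hU.connectedComponentIn.frontier_eq] at hy
  obtain ⟨z, hz, hz'⟩ := mem_closure_iff.1 hy.1 _ hU.connectedComponentIn
    (mem_connectedComponentIn hyU)
  refine hy.2 ?_
  rw [connectedComponentIn_eq hz', ← connectedComponentIn_eq hz]
  exact mem_connectedComponentIn hyU

theorem isPreconnected_setOf_lt_norm {R : ℝ} (hR : 0 < R) : IsPreconnected {z : ℂ | R < ‖z‖} := by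
  have h : {z : ℂ | R < ‖z‖} = Complex.exp '' {w | Real.log R < w.re} := by
    ext z
    constructor
    · intro (hz : R < ‖z‖)
      have h0 : z ≠ 0 := norm_pos_iff.1 (hR.trans hz)
      exact ⟨Complex.log z, by simpa [Complex.log_re] using Real.log_lt_log hR hz, Complex.exp_log h0⟩
    · rintro ⟨w, hw, rfl⟩
      simpa [Complex.norm_exp, ← Real.log_lt_iff_lt_exp hR] using hw
  rw [h]
  exact (convex_halfSpace_re_gt _).isPreconnected.image _ Complex.continuous_exp.continuousOn

/-- The complement of a bounded plane set has at most one unbounded component. -/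
theorem connectedComponentIn_compl_eq_of_not_isBounded {K : Set ℂ} (hK : Bornology.IsBounded K)
    {a b : ℂ} (ha : ¬ Bornology.IsBounded (connectedComponentIn Kᶜ a))
    (hb : ¬ Bornology.IsBounded (connectedComponentIn Kᶜ b)) :
    connectedComponentIn Kᶜ a = connectedComponentIn Kᶜ b := by
  obtain ⟨R, hR0, hR⟩ := hK.exists_pos_norm_le
  have hsub : {z : ℂ | R < ‖z‖} ⊆ Kᶜ := fun z (hz : R < ‖z‖) hzK => (hR z hzK).not_gt hz
  have key : ∀ c : ℂ, ¬ Bornology.IsBounded (connectedComponentIn Kᶜ c) →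
      ∃ z ∈ connectedComponentIn Kᶜ c, R < ‖z‖ := by
    intro c hc
    by_contra! h
    exact hc (isBounded_iff_forall_norm_le.2 ⟨R, h⟩)
  obtain ⟨x, hx, hxR⟩ := key a ha
  obtain ⟨y, hy, hyR⟩ := key b hb
  rw [connectedComponentIn_eq hx, connectedComponentIn_eq hy]
  exact connectedComponentIn_eq
    ((isPreconnected_setOf_lt_norm hR0).subset_connectedComponentIn hxR hsub hyR)

/-- The component of `a` has its frontier in `K`, so its closure avoids `b` and `c`, and the other
two factors do not vanish there. The points `b` and `c` may coincide, which covers products of two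
factors. -/
theorem exponent_eq_zero_of_hasLogOn {K : Set ℂ} (hK : IsCompact K) {a b c : ℂ} (ha : a ∉ K)
    (hb : b ∉ K) (hc : c ∉ K) (hbdd : Bornology.IsBounded (connectedComponentIn Kᶜ a))
    (hab : b ∉ connectedComponentIn Kᶜ a) (hac : c ∉ connectedComponentIn Kᶜ a) {i j k : ℤ}
    (h : HasLogOn (fun z => (z - a) ^ i * ((z - b) ^ j * (z - c) ^ k)) K) : i = 0 := by
  have hopen : IsOpen Kᶜ := hK.isClosed.isOpen_compl
  have hfr : frontier (connectedComponentIn Kᶜ a) ⊆ K := by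
    simpa using frontier_connectedComponentIn_subset hopen a
  have hcl : ∀ d ∉ K, d ∉ connectedComponentIn Kᶜ a →
      ∀ z ∈ closure (connectedComponentIn Kᶜ a), z - d ≠ 0 := by
    intro d hd hda z hz h
    rw [sub_eq_zero] at h
    subst h
    exact hd (hfr ⟨hz, fun h => hda (interior_subset h)⟩)
  refine eq_zero_of_hasLogOn_frontier hbdd ?_ ?_ ?_ (h.mono hfr)
  · rw [hopen.connectedComponentIn.interior_eq]
    exact mem_connectedComponentIn ha
  · exact (ContinuousOn.zpow₀ (by fun_prop) _ fun z hz => .inl (hcl b hb hab z hz)).mul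
      (ContinuousOn.zpow₀ (by fun_prop) _ fun z hz => .inl (hcl c hc hac z hz))
  · exact fun z hz => mul_ne_zero (zpow_ne_zero _ (hcl b hb hab z hz))
      (zpow_ne_zero _ (hcl c hc hac z hz))

theorem notMem_connectedComponentIn_of_ne {X : Type*} [TopologicalSpace X] {U : Set X} {a b : X}
    (h : connectedComponentIn U a ≠ connectedComponentIn U b) : b ∉ connectedComponentIn U a :=
  fun h' => h (connectedComponentIn_eq h')

/-- A product of powers of `z - a`, `z - b`, `z - c` of total degree zero has a logarithm on `K`
only if it is trivial, when `a`, `b`, `c` are in distinct components of the complement. -/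
theorem exponents_eq_zero_of_hasLogOn {K : Set ℂ} (hK : IsCompact K) {a b c : ℂ} (ha : a ∉ K)
    (hb : b ∉ K) (hc : c ∉ K) (hab : connectedComponentIn Kᶜ a ≠ connectedComponentIn Kᶜ b)
    (hac : connectedComponentIn Kᶜ a ≠ connectedComponentIn Kᶜ c)
    (hbc : connectedComponentIn Kᶜ b ≠ connectedComponentIn Kᶜ c) {i j k : ℤ}
    (hijk : i + j + k = 0)
    (h : HasLogOn (fun z => (z - a) ^ i * ((z - b) ^ j * (z - c) ^ k)) K) :
    i = 0 ∧ j = 0 := by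
  have hi := fun hbd => exponent_eq_zero_of_hasLogOn hK ha hb hc hbd
    (notMem_connectedComponentIn_of_ne hab) (notMem_connectedComponentIn_of_ne hac) h
  have hj := fun hbd => exponent_eq_zero_of_hasLogOn hK hb ha hc hbd
    (notMem_connectedComponentIn_of_ne hab.symm) (notMem_connectedComponentIn_of_ne hbc)
    (i := j) (j := i) (k := k) (h.congr fun z _ => by ring)
  have hk := fun hbd => exponent_eq_zero_of_hasLogOn hK hc ha hb hbd
    (notMem_connectedComponentIn_of_ne hac.symm) (notMem_connectedComponentIn_of_ne hbc.symm)
    (i := k) (j := i) (k := j) (h.congr fun z _ => by ring)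
  -- At most one of the three components is unbounded: two exponents vanish directly, the third
  -- because the total degree is zero.
  by_cases h1 : Bornology.IsBounded (connectedComponentIn Kᶜ a)
  · by_cases h2 : Bornology.IsBounded (connectedComponentIn Kᶜ b)
    · exact ⟨hi h1, hj h2⟩
    · have h3 : Bornology.IsBounded (connectedComponentIn Kᶜ c) := by
        by_contra h3
        exact hbc (connectedComponentIn_compl_eq_of_not_isBounded hK.isBounded h2 h3)
      have := hi h1
      have := hk h3
      omega
  · have h2 : Bornology.IsBounded (connectedComponentIn Kᶜ b) := by
      by_contra h2
      exact hab (connectedComponentIn_compl_eq_of_not_isBounded hK.isBounded h1 h2)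
    have h3 : Bornology.IsBounded (connectedComponentIn Kᶜ c) := by
      by_contra h3
      exact hac (connectedComponentIn_compl_eq_of_not_isBounded hK.isBounded h1 h3)
    have := hj h2
    have := hk h3
    omega

/-! ### Separation properties of an arc attached to a compact set. -/

section arc

variable {H : Set ℂ} {γ : I → ℂ}

theorem sub_div_sub_ne_zero {a b z : ℂ} (ha : z ≠ a) (hb : z ≠ b) : (z - a) / (z - b) ≠ 0 :=
  div_ne_zero (sub_ne_zero.2 ha) (sub_ne_zero.2 hb)

theorem hasLogOn_sub_div_sub_range_arc (hγ : Continuous γ) (hi : Function.Injective γ) {a b : ℂ}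
    (ha : a ∉ range γ) (hb : b ∉ range γ) :
    HasLogOn (fun z => (z - a) / (z - b)) (range γ) := by
  have hne : ∀ c ∉ range γ, ∀ z ∈ range γ, z ≠ c := fun c hc z hz h => hc (h ▸ hz)
  exact .of_range_arc (hγ.isClosedEmbedding hi).isEmbedding
    (ContinuousOn.div (by fun_prop) (by fun_prop) fun z hz => sub_ne_zero.2 (hne b hb z hz))
    fun z hz => sub_div_sub_ne_zero (hne a ha z hz) (hne b hb z hz)

/-- Attaching an arc at a single point does not separate. -/
theorem connectedComponentIn_compl_union_arc_eq (hH : IsCompact H) (hγ : Continuous γ)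
    (hi : Function.Injective γ) (hp : (H ∩ range γ).Subsingleton) {C : Set ℂ}
    (hC : IsPreconnected C) (hHC : Disjoint H C) {a b : ℂ} (ha : a ∈ C) (hb : b ∈ C)
    (haγ : a ∉ range γ) (hbγ : b ∉ range γ) :
    connectedComponentIn (H ∪ range γ)ᶜ a = connectedComponentIn (H ∪ range γ)ᶜ b := by
  by_contra hne
  have hγc : IsCompact (range γ) := isCompact_range hγ
  have hK : IsCompact (H ∪ range γ) := hH.union hγc
  have haK : a ∉ H ∪ range γ := fun h => h.elim (fun h => hHC.ne_of_mem h ha rfl) haγ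
  have hbK : b ∉ H ∪ range γ := fun h => h.elim (fun h => hHC.ne_of_mem h hb rfl) hbγ
  have h := (hasLogOn_sub_div_sub hH hC hHC ha hb).union_of_isPreconnected hH.isClosed
    hγc.isClosed hp.isPreconnected (hasLogOn_sub_div_sub_range_arc hγ hi haγ hbγ)
  by_cases h1 : Bornology.IsBounded (connectedComponentIn (H ∪ range γ)ᶜ a)
  · refine one_ne_zero (exponent_eq_zero_of_hasLogOn hK haK hbK hbK h1
      (notMem_connectedComponentIn_of_ne hne) (notMem_connectedComponentIn_of_ne hne)
      (i := 1) (j := -1) (k := 0) (h.congr fun z _ => ?_))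
    simp [div_eq_mul_inv]
  · have h2 : Bornology.IsBounded (connectedComponentIn (H ∪ range γ)ᶜ b) := by
      by_contra h2
      exact hne (connectedComponentIn_compl_eq_of_not_isBounded hK.isBounded h1 h2)
    refine one_ne_zero (neg_eq_zero.1 (exponent_eq_zero_of_hasLogOn hK hbK haK haK h2
      (notMem_connectedComponentIn_of_ne (Ne.symm hne))
      (notMem_connectedComponentIn_of_ne (Ne.symm hne))
      (i := -1) (j := 1) (k := 0) (h.congr fun z _ => ?_)))
    simp [div_eq_inv_mul]

/-- Attaching an arc at its two ends separates a region into at most two pieces. -/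
theorem connectedComponentIn_compl_union_arc_eq_or (hH : IsCompact H) (hγ : Continuous γ)
    (hi : Function.Injective γ) {p q : ℂ} (hpq : H ∩ range γ = {p, q}) {C : Set ℂ}
    (hC : IsPreconnected C) (hHC : Disjoint H C) {a b c : ℂ} (ha : a ∈ C) (hb : b ∈ C)
    (hc : c ∈ C) (haγ : a ∉ range γ) (hbγ : b ∉ range γ) (hcγ : c ∉ range γ) :
    connectedComponentIn (H ∪ range γ)ᶜ a = connectedComponentIn (H ∪ range γ)ᶜ b ∨
    connectedComponentIn (H ∪ range γ)ᶜ a = connectedComponentIn (H ∪ range γ)ᶜ c ∨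
    connectedComponentIn (H ∪ range γ)ᶜ b = connectedComponentIn (H ∪ range γ)ᶜ c := by
  by_contra! hne
  obtain ⟨hab, hac, hbc⟩ := hne
  have hγc : IsCompact (range γ) := isCompact_range hγ
  have hK : IsCompact (H ∪ range γ) := hH.union hγc
  have hmem : ∀ x ∈ C, x ∉ range γ → x ∉ H ∪ range γ := fun x hx hxγ h =>
    h.elim (fun h => hHC.ne_of_mem h hx rfl) hxγ
  have hcK := hmem c hc hcγ
  obtain ⟨g, hg, e⟩ := hasLogOn_sub_div_sub hH hC hHC ha hc
  obtain ⟨g', hg', e'⟩ := hasLogOn_sub_div_sub_range_arc hγ hi haγ hcγ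
  obtain ⟨u, hu, v⟩ := hasLogOn_sub_div_sub hH hC hHC hb hc
  obtain ⟨u', hu', v'⟩ := hasLogOn_sub_div_sub_range_arc hγ hi hbγ hcγ
  have hp : p ∈ H ∩ range γ := hpq ▸ mem_insert _ _
  have hq : q ∈ H ∩ range γ := hpq ▸ mem_insert_of_mem _ rfl
  have hint : ∀ z ∈ H ∩ range γ, (∃ n : ℤ, g z = g' z + n * (2 * Real.pi * Complex.I)) ∧
      ∃ n : ℤ, u z = u' z + n * (2 * Real.pi * Complex.I) := fun z hz =>
    ⟨Complex.exp_eq_exp_iff_exists_int.1 ((e z hz.1).symm.trans (e' z hz.2)),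
      Complex.exp_eq_exp_iff_exists_int.1 ((v z hz.1).symm.trans (v' z hz.2))⟩
  obtain ⟨⟨m, hm⟩, n, hn⟩ := hint p hp
  obtain ⟨⟨m', hm'⟩, n', hn'⟩ := hint q hq
  -- On `H` and on the arc the chosen logarithms differ by `m`, `n` (in units of `2πi`) at `p` and
  -- by `m'`, `n'` at `q`. When the combination with coefficients `i`, `j` has equal discrepancies
  -- at both points, one shift makes the logarithms agree and they glue.
  have key : ∀ i j : ℤ, i * (m' - m) + j * (n' - n) = 0 → i = 0 ∧ j = 0 := by
    intro i j hij
    refine exponents_eq_zero_of_hasLogOn hK (hmem a ha haγ) (hmem b hb hbγ) hcK hab hac hbc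
      (i := i) (j := j) (k := - i - j) (by ring) ?_
    refine HasLogOn.congr (f := fun z => ((z - a) / (z - c)) ^ i * ((z - b) / (z - c)) ^ j)
      (HasLogOn.union (g := fun z => i * g z + j * u z)
      (g' := fun z => i * g' z + j * u' z + (i * m + j * n : ℤ) * (2 * Real.pi * Complex.I))
      hH.isClosed hγc.isClosed (by fun_prop) (by fun_prop) ?_ ?_ ?_) ?_
    · intro z hz
      have h1 := e z hz
      have h2 := v z hz
      simp only at h1 h2 ⊢
      rw [Complex.exp_add, Complex.exp_int_mul, Complex.exp_int_mul, h1, h2]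
    · intro z hz
      have h1 := e' z hz
      have h2 := v' z hz
      simp only at h1 h2 ⊢
      rw [Complex.exp_add, Complex.exp_int_mul_two_pi_mul_I, mul_one, Complex.exp_add,
        Complex.exp_int_mul, Complex.exp_int_mul, h1, h2]
    · intro z hz
      rw [hpq] at hz
      rcases hz with rfl | rfl
      · simp only [hm, hn]; push_cast; ring
      · have hij' : (i : ℂ) * (m' - m) + j * (n' - n) = 0 := by exact_mod_cast hij
        simp only [hm', hn']
        push_cast
        linear_combination (2 * Real.pi * Complex.I : ℂ) * hij'
    · intro z hz
      have hzc : z - c ≠ 0 := sub_ne_zero.2 fun h => hcK (h ▸ hz)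
      rw [div_zpow, div_zpow, sub_eq_add_neg (-i), zpow_add₀ hzc, zpow_neg, zpow_neg]
      ring
  -- A linear form on `ℤ²` has a nonzero kernel vector, contradicting `key`.
  by_cases hmm : m' - m = 0
  · exact one_ne_zero (key 1 0 (by simp [hmm])).1
  · exact hmm (neg_eq_zero.1 (key (n' - n) (-(m' - m)) (by ring)).2)

/-- A compact subset of a connected open set is contained in a compact connected subset. -/
theorem exists_isCompact_isPreconnected_between {Q O : Set ℂ} (hQ : IsCompact Q) (hO : IsOpen O)
    (hc : IsPreconnected O) (hQO : Q ⊆ O) :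
    ∃ L, IsCompact L ∧ IsPreconnected L ∧ Q ⊆ L ∧ L ⊆ O := by
  rcases O.eq_empty_or_nonempty with rfl | ⟨x₀, hx₀⟩
  · exact ⟨∅, isCompact_empty, isPreconnected_empty, hQO, subset_rfl⟩
  have hpc : IsPathConnected O := hO.isConnected_iff_isPathConnected.1 ⟨⟨x₀, hx₀⟩, hc⟩
  -- Requiring a common base point makes unions of connected sets connected, so the compact
  -- induction goes through.
  suffices ∃ L, IsCompact L ∧ IsPreconnected L ∧ Q ⊆ L ∧ L ⊆ O ∧ x₀ ∈ L from
    let ⟨L, h1, h2, h3, h4, _⟩ := this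
    ⟨L, h1, h2, h3, h4⟩
  refine hQ.induction_on (p := fun Q => ∃ L, IsCompact L ∧ IsPreconnected L ∧ Q ⊆ L ∧ L ⊆ O ∧
    x₀ ∈ L) ?_ ?_ ?_ ?_
  · exact ⟨{x₀}, isCompact_singleton, isPreconnected_singleton, empty_subset _, by simpa, rfl⟩
  · rintro s t hst ⟨L, h1, h2, h3, h4⟩
    exact ⟨L, h1, h2, hst.trans h3, h4⟩
  · rintro s t ⟨L, h1, h2, h3, h4, h5⟩ ⟨L', h1', h2', h3', h4', h5'⟩
    exact ⟨L ∪ L', h1.union h1', h2.union x₀ h5 h5' h2', union_subset_union h3 h3',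
      union_subset h4 h4', .inl h5⟩
  · intro x hx
    obtain ⟨r, hr, hrO⟩ := Metric.nhds_basis_closedBall.mem_iff.1 (hO.mem_nhds (hQO hx))
    obtain ⟨δ, hδ⟩ := hpc.joinedIn x₀ hx₀ x (hQO hx)
    refine ⟨Metric.closedBall x r, mem_nhdsWithin_of_mem_nhds (Metric.closedBall_mem_nhds x hr),
      range δ ∪ Metric.closedBall x r, (isCompact_range δ.continuous).union
      (isCompact_closedBall _ _), ?_, subset_union_right, union_subset ?_ hrO,
      .inl ⟨0, δ.source⟩⟩
    · exact (isPreconnected_range δ.continuous).union x ⟨1, δ.target⟩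
        (Metric.mem_closedBall_self hr.le) (convex_closedBall _ _).isPreconnected
    · rintro _ ⟨t, rfl⟩
      exact hδ t

/-- Attaching an arc at its two ends to a connected set separates the region that contains it. -/
theorem not_isPreconnected_diff_arc (hH : IsPreconnected H) (hγ : Continuous γ)
    {p q : ℂ} (hne : p ≠ q) (hpH : p ∈ H) (hqH : q ∈ H) (hpγ : p ∈ range γ) (hqγ : q ∈ range γ)
    {D : Set ℂ} (hD : IsOpen D) (hHD : Disjoint H D)
    (hγD : range γ \ {p, q} ⊆ D) : ¬ IsPreconnected (D \ range γ) := by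
  intro hpre
  have hγc : IsCompact (range γ) := isCompact_range hγ
  set r := dist p q / 2 with hr
  have hr0 : 0 < r := by rw [hr]; exact half_pos (dist_pos.2 hne)
  have hqr : q ∉ Metric.closedBall p r := by
    rw [Metric.mem_closedBall, dist_comm]
    linarith
  -- This circle separates `p` from `q`, so `(z - p) / (z - q)` has no logarithm on it. One is
  -- constructed by cutting the circle into a part `S ∩ M` inside `D`, hence off `H`, and a part off
  -- the arc.
  set S := Metric.sphere p r
  have hS : IsCompact S := isCompact_sphere _ _
  have hSγ : S ∩ range γ ⊆ D := fun z hz => hγD ⟨hz.2, by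
    rintro (rfl | rfl)
    · have := hz.1
      simp only [S, Metric.mem_sphere, dist_self] at this
      exact hr0.ne this
    · exact hqr (Metric.sphere_subset_closedBall hz.1)⟩
  obtain ⟨M, hM, hSM, hMD⟩ := exists_compact_between (hS.inter hγc) hD hSγ
  have hQ : IsCompact ((S ∩ M) \ interior M) := (hS.inter hM).diff isOpen_interior
  -- The two parts overlap in `(S ∩ M) \ interior M`, which may be disconnected. The assumed
  -- connectedness of `D \ range γ` supplies a connected `L` containing the overlap and avoiding
  -- both `H` and the arc; adding it to both parts makes their intersection exactly `L`.
  obtain ⟨L, hL, hLp, hQL, hLD⟩ := exists_isCompact_isPreconnected_between hQ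
    (hD.sdiff hγc.isClosed) hpre fun z hz =>
      ⟨hMD hz.1.2, fun hzγ => hz.2 (hSM ⟨hz.1.1, hzγ⟩)⟩
  have h1 : HasLogOn (fun z => (z - p) / (z - q)) ((S ∩ M) ∪ L) :=
    hasLogOn_sub_div_sub ((hS.inter hM).union hL) hH
      (hHD.symm.mono_left (union_subset (inter_subset_right.trans hMD)
        (hLD.trans sdiff_subset))) hpH hqH
  have h2 : HasLogOn (fun z => (z - p) / (z - q)) ((S \ interior M) ∪ L) := by
    refine hasLogOn_sub_div_sub ((hS.diff isOpen_interior).union hL) (isPreconnected_range hγ)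
      ?_ hpγ hqγ
    rw [disjoint_union_left]
    refine ⟨disjoint_left.2 fun z hz hzγ => hz.2 (hSM ⟨hz.1, hzγ⟩), ?_⟩
    exact disjoint_left.2 fun z hz => (hLD hz).2
  have h3 := h1.union_of_isPreconnected ((hS.inter hM).union hL).isClosed
    ((hS.diff isOpen_interior).union hL).isClosed ?_ h2
  · have h4 : HasLogOn (fun z => (z - p) / (z - q)) (frontier (Metric.ball p r)) := by
      rw [frontier_ball _ hr0.ne']
      refine h3.mono fun z hz => ?_
      by_cases hzM : z ∈ interior M
      · exact .inl (.inl ⟨hz, interior_subset hzM⟩)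
      · exact .inr (.inl ⟨hz, hzM⟩)
    have hcl : ∀ z ∈ closure (Metric.ball p r), z - q ≠ 0 := fun z hz h =>
      hqr (sub_eq_zero.1 h ▸ Metric.closure_ball_subset_closedBall hz)
    refine one_ne_zero (eq_zero_of_hasLogOn_frontier (k := 1) (a := p)
      (h := fun z => (z - q)⁻¹) Metric.isBounded_ball ?_ ?_ ?_ (h4.congr fun z _ => ?_))
    · rw [Metric.isOpen_ball.interior_eq]
      exact Metric.mem_ball_self hr0
    · exact ContinuousOn.inv₀ (by fun_prop) hcl
    · exact fun z hz => inv_ne_zero (hcl z hz)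
    · simp [div_eq_mul_inv]
  · convert hLp using 1
    ext z
    refine ⟨?_, fun hz => ⟨.inr hz, .inr hz⟩⟩
    rintro ⟨hz | hz, hz' | hz'⟩
    · exact hQL ⟨hz, hz'.2⟩
    all_goals assumption

end arc

/-! ### Counting components after removing a set. -/

/-- The connected components of a subset of a topological space. -/
def componentsIn {X : Type*} [TopologicalSpace X] (U : Set X) : Set (Set X) :=
  {f | ∃ x ∈ U, f = connectedComponentIn U x}

section componentsIn

variable {X : Type*} [TopologicalSpace X]

theorem componentsIn_encard_eq_one {U : Set X} (h : IsPreconnected U) (hne : U.Nonempty) :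
    (componentsIn U).encard = 1 := by
  obtain ⟨x, hx⟩ := hne
  refine encard_eq_one.2 ⟨U, Subset.antisymm ?_ ?_⟩
  · rintro _ ⟨y, hy, rfl⟩
    exact h.connectedComponentIn hy
  · rintro _ rfl
    exact ⟨x, hx, (h.connectedComponentIn hx).symm⟩

theorem connectedComponentIn_connectedComponentIn_diff {U e : Set X} {x y : X}
    (hy : y ∈ connectedComponentIn U x \ e) :
    connectedComponentIn (connectedComponentIn U x \ e) y = connectedComponentIn (U \ e) y := by
  have hsub : connectedComponentIn U x \ e ⊆ U \ e :=
    fun z hz => ⟨connectedComponentIn_subset _ _ hz.1, hz.2⟩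
  refine Subset.antisymm (connectedComponentIn_mono _ hsub) ?_
  refine isPreconnected_connectedComponentIn.subset_connectedComponentIn
    (mem_connectedComponentIn (hsub hy)) fun z hz => ⟨?_, (connectedComponentIn_subset _ _ hz).2⟩
  rw [connectedComponentIn_eq hy.1]
  exact connectedComponentIn_mono y sdiff_subset hz

/-- Removing a set contained in one component only affects that component. -/
theorem componentsIn_diff {U e : Set X} {x : X} (he : U ∩ e ⊆ connectedComponentIn U x) :
    componentsIn (U \ e) =
      componentsIn U \ {connectedComponentIn U x} ∪ componentsIn (connectedComponentIn U x \ e) := by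
  have hsub : connectedComponentIn U x \ e ⊆ U \ e :=
    fun z hz => ⟨connectedComponentIn_subset _ _ hz.1, hz.2⟩
  have hout : ∀ y ∈ U, y ∉ connectedComponentIn U x →
      y ∉ e ∧ connectedComponentIn (U \ e) y = connectedComponentIn U y := by
    intro y hy hyx
    have hye : y ∉ e := fun h => hyx (he ⟨hy, h⟩)
    refine ⟨hye, Subset.antisymm (connectedComponentIn_mono _ sdiff_subset) ?_⟩
    refine isPreconnected_connectedComponentIn.subset_connectedComponentIn
      (mem_connectedComponentIn hy) fun z hz => ⟨connectedComponentIn_subset _ _ hz, fun hze => ?_⟩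
    have hzx := he ⟨connectedComponentIn_subset _ _ hz, hze⟩
    refine hyx ?_
    rw [connectedComponentIn_eq hzx, ← connectedComponentIn_eq hz]
    exact mem_connectedComponentIn hy
  ext c
  constructor
  · rintro ⟨y, hy, rfl⟩
    by_cases hyx : y ∈ connectedComponentIn U x
    · exact .inr ⟨y, ⟨hyx, hy.2⟩, (connectedComponentIn_connectedComponentIn_diff ⟨hyx, hy.2⟩).symm⟩
    · refine .inl ⟨⟨y, hy.1, (hout y hy.1 hyx).2⟩, fun h => hyx ?_⟩
      rw [mem_singleton_iff, (hout y hy.1 hyx).2] at h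
      rw [← h]
      exact mem_connectedComponentIn hy.1
  · rintro (⟨⟨y, hy, rfl⟩, hne⟩ | ⟨y, hy, rfl⟩)
    · have hyx : y ∉ connectedComponentIn U x := fun h => hne (connectedComponentIn_eq h).symm
      obtain ⟨h1, h2⟩ := hout y hy hyx
      exact ⟨y, ⟨hy, h1⟩, h2.symm⟩
    · exact ⟨y, hsub hy, connectedComponentIn_connectedComponentIn_diff hy⟩

/-- One component is replaced by its pieces; the `+ 1` avoids subtraction in `ℕ∞`. -/
theorem encard_componentsIn_diff {U e : Set X} {x : X} (hx : x ∈ U)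
    (he : U ∩ e ⊆ connectedComponentIn U x) :
    (componentsIn (U \ e)).encard + 1 =
      (componentsIn U).encard + (componentsIn (connectedComponentIn U x \ e)).encard := by
  have hdisj : Disjoint (componentsIn U \ {connectedComponentIn U x})
      (componentsIn (connectedComponentIn U x \ e)) := by
    rw [disjoint_left]
    rintro _ ⟨⟨y, hy, rfl⟩, hne⟩ ⟨z, hz, h⟩
    have hyx : y ∈ connectedComponentIn U x := by
      have := mem_connectedComponentIn hy
      rw [h] at this
      exact (connectedComponentIn_subset _ _ this).1
    exact hne (connectedComponentIn_eq hyx).symm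
  have hmem : connectedComponentIn U x ∈ componentsIn U := ⟨x, hx, rfl⟩
  rw [componentsIn_diff he, encard_union_eq hdisj, add_right_comm,
    encard_sdiff_singleton_add_one hmem]

end componentsIn

/-! ### Arcs have empty interior. -/

/-- There is no continuous injection from the plane to the line. -/
theorem not_injective_of_continuous {ψ : ℂ → ℝ} (hψ : Continuous ψ) : ¬ Function.Injective ψ := by
  intro hi
  have key : ∀ a b : ℂ, ψ a < ψ b → False := by
    intro a b hab
    -- The value `v` is attained at some `c`, and again on the still connected plane minus `c`.
    obtain ⟨v, hv⟩ := exists_between hab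
    obtain ⟨c, -, hc⟩ := (isPreconnected_univ (α := ℂ)).intermediate_value (mem_univ a)
      (mem_univ b) hψ.continuousOn ⟨hv.1.le, hv.2.le⟩
    have hca : a ∈ ({c}ᶜ : Set ℂ) := by rintro rfl; exact hv.1.ne hc
    have hcb : b ∈ ({c}ᶜ : Set ℂ) := by rintro rfl; exact hv.2.ne' hc
    have hpre : IsPreconnected ({c}ᶜ : Set ℂ) :=
      (isConnected_compl_singleton_of_one_lt_rank (by simp) c).isPreconnected
    obtain ⟨d, hd, hdv⟩ := hpre.intermediate_value hca hcb hψ.continuousOn ⟨hv.1.le, hv.2.le⟩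
    exact hd (hi (hdv.trans hc.symm))
  rcases lt_or_gt_of_ne (hi.ne (zero_ne_one : (0 : ℂ) ≠ 1)) with h | h
  exacts [key _ _ h, key _ _ h]

/-- An arc contains no homeomorphic image of a nonempty open subset of the plane. -/
theorem not_image_subset_range_arc {X : Type*} [TopologicalSpace X] {γ : I → X}
    (hγ : IsEmbedding γ) {j : ℂ → X} (hj : Continuous j) (hi : Function.Injective j) {O : Set ℂ}
    (hO : IsOpen O) (hne : O.Nonempty) : ¬ j '' O ⊆ range γ := by
  intro hsub
  obtain ⟨c, hc⟩ := hne
  obtain ⟨r, hr, hrO⟩ := Metric.isOpen_iff.1 hO c hc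
  -- A homeomorphism of the plane onto a ball in `O`; an inclusion in the arc would then inject the
  -- plane into the line.
  let u := OpenPartialHomeomorph.univBall c r
  have hu : Continuous u := OpenPartialHomeomorph.continuous_univBall c r
  have hui : Function.Injective u := by
    rw [← injOn_univ, ← OpenPartialHomeomorph.univBall_source c r]
    exact u.injOn
  have hmem : ∀ z, j (u z) ∈ range γ := fun z => hsub ⟨_, hrO (by
    rw [← OpenPartialHomeomorph.univBall_target c hr]
    exact u.map_source (by simp [u])), rfl⟩
  have hc : Continuous fun z => hγ.toHomeomorph.symm ⟨j (u z), hmem z⟩ := by fun_prop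
  refine not_injective_of_continuous (continuous_subtype_val.comp hc) fun z w h => ?_
  have := hγ.toHomeomorph.symm.injective (Subtype.val_injective h)
  exact hui (hi (congrArg Subtype.val this))

/-! ### The number of components after attaching an arc. -/

section attach

variable {H : Set ℂ} {γ : I → ℂ}

theorem range_arc_eq : range γ = γ '' Ioo 0 1 ∪ {γ 0, γ 1} := by
  ext z
  constructor
  · rintro ⟨t, rfl⟩
    rcases eq_or_lt_of_le t.2.1 with h | h
    · exact .inr (.inl (congrArg γ (Subtype.ext h.symm)))
    rcases eq_or_lt_of_le t.2.2 with h' | h'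
    · exact .inr (.inr (congrArg γ (Subtype.ext h')))
    · exact .inl ⟨t, ⟨h, h'⟩, rfl⟩
  · rintro (⟨t, -, rfl⟩ | rfl | rfl) <;> exact mem_range_self _

/-- The parameters mapped outside `H` lie between the open interval and its closure, so they form a
connected set whether or not the ends of the arc lie in `H`. -/
theorem compl_inter_range_arc_subset (hγ : Continuous γ) (hIoo : ∀ t ∈ Ioo 0 1, γ t ∉ H)
    {t : I} (ht : t ∈ Ioo 0 1) : Hᶜ ∩ range γ ⊆ connectedComponentIn Hᶜ (γ t) := by
  have h : Hᶜ ∩ range γ = γ '' (γ ⁻¹' Hᶜ) := by rw [image_preimage_eq_inter_range]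
  rw [h]
  refine IsPreconnected.subset_connectedComponentIn ?_ (mem_image_of_mem γ (hIoo t ht))
    (image_preimage_subset _ _)
  refine IsPreconnected.image ?_ _ hγ.continuousOn
  refine (isPreconnected_Ioo (a := (0 : I)) (b := 1)).subset_closure hIoo ?_
  rw [closure_Ioo zero_ne_one]
  exact fun s _ => ⟨s.2.1, s.2.2⟩

theorem exists_mem_Ioo_unitInterval : ∃ t : I, t ∈ Ioo 0 1 := exists_between zero_lt_one

/-- Attaching an arc at a single point does not change the number of components of the
complement. -/
theorem encard_componentsIn_compl_union_arc (hH : IsCompact H) (hγ : Continuous γ)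
    (hi : Function.Injective γ) (hIoo : ∀ t ∈ Ioo 0 1, γ t ∉ H)
    (hp : (H ∩ range γ).Subsingleton) :
    (componentsIn (H ∪ range γ)ᶜ).encard = (componentsIn Hᶜ).encard := by
  obtain ⟨t, ht⟩ := exists_mem_Ioo_unitInterval
  have hd : (H ∪ range γ)ᶜ = Hᶜ \ range γ := by rw [compl_union, sdiff_eq]
  have hopen : IsOpen (connectedComponentIn Hᶜ (γ t)) :=
    hH.isClosed.isOpen_compl.connectedComponentIn
  have hdisj : Disjoint H (connectedComponentIn Hᶜ (γ t)) :=
    disjoint_left.2 fun z hz hz' => connectedComponentIn_subset _ _ hz' hz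
  have hD : (componentsIn (connectedComponentIn Hᶜ (γ t) \ range γ)).encard = 1 := by
    obtain ⟨a, haD, haγ⟩ : (connectedComponentIn Hᶜ (γ t) \ range γ).Nonempty := by
      have := not_image_subset_range_arc (hγ.isClosedEmbedding hi).isEmbedding continuous_id
        Function.injective_id hopen ⟨γ t, mem_connectedComponentIn (hIoo t ht)⟩
      rw [image_id, not_subset] at this
      exact this
    refine encard_eq_one.2 ⟨connectedComponentIn (H ∪ range γ)ᶜ a, Subset.antisymm ?_ ?_⟩
    · rintro _ ⟨b, hb, rfl⟩
      rw [mem_singleton_iff, connectedComponentIn_connectedComponentIn_diff hb, ← hd]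
      exact connectedComponentIn_compl_union_arc_eq hH hγ hi hp isPreconnected_connectedComponentIn
        hdisj hb.1 haD hb.2 haγ
    · rintro _ rfl
      refine ⟨a, ⟨haD, haγ⟩, ?_⟩
      rw [connectedComponentIn_connectedComponentIn_diff ⟨haD, haγ⟩, ← hd]
  have := encard_componentsIn_diff (hIoo t ht) (compl_inter_range_arc_subset hγ hIoo ht)
  rw [hD, ← hd] at this
  exact WithTop.add_right_cancel ENat.one_ne_top this

/-- Attaching an arc at its two ends to a connected set increases the number of components of the
complement by one. -/
theorem encard_componentsIn_compl_union_arc_add_one (hH : IsCompact H) (hHc : IsPreconnected H)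
    (hγ : Continuous γ) (hi : Function.Injective γ) (hIoo : ∀ t ∈ Ioo 0 1, γ t ∉ H)
    (h0 : γ 0 ∈ H) (h1 : γ 1 ∈ H) :
    (componentsIn (H ∪ range γ)ᶜ).encard = (componentsIn Hᶜ).encard + 1 := by
  obtain ⟨t, ht⟩ := exists_mem_Ioo_unitInterval
  have hd : (H ∪ range γ)ᶜ = Hᶜ \ range γ := by rw [compl_union, sdiff_eq]
  have hopen : IsOpen (connectedComponentIn Hᶜ (γ t)) :=
    hH.isClosed.isOpen_compl.connectedComponentIn
  have hsub := compl_inter_range_arc_subset hγ hIoo ht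
  have hdisj : Disjoint H (connectedComponentIn Hᶜ (γ t)) :=
    disjoint_left.2 fun z hz hz' => connectedComponentIn_subset _ _ hz' hz
  have hinter : H ∩ range γ = {γ 0, γ 1} := by
    refine Subset.antisymm ?_ ?_
    · rintro z ⟨hz, hzγ⟩
      rw [range_arc_eq] at hzγ
      rcases hzγ with ⟨s, hs, rfl⟩ | hz'
      · exact absurd hz (hIoo s hs)
      · exact hz'
    · rintro _ (rfl | rfl)
      exacts [⟨h0, mem_range_self _⟩, ⟨h1, mem_range_self _⟩]
  have hD : (componentsIn (connectedComponentIn Hᶜ (γ t) \ range γ)).encard = 2 := by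
    have hnot : ¬ IsPreconnected (connectedComponentIn Hᶜ (γ t) \ range γ) :=
      not_isPreconnected_diff_arc hHc hγ (hi.ne zero_ne_one) h0 h1 (mem_range_self _)
        (mem_range_self _) hopen hdisj fun z hz => hsub ⟨fun hzH => hz.2 (hinter ▸ ⟨hzH, hz.1⟩), hz.1⟩
    obtain ⟨a, ha, b, hb, hab⟩ : ∃ a ∈ connectedComponentIn Hᶜ (γ t) \ range γ,
        ∃ b ∈ connectedComponentIn Hᶜ (γ t) \ range γ,
          connectedComponentIn (H ∪ range γ)ᶜ a ≠ connectedComponentIn (H ∪ range γ)ᶜ b := by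
      by_contra! h
      refine hnot (isPreconnected_of_forall_pair fun a ha b hb => ?_)
      refine ⟨connectedComponentIn (connectedComponentIn Hᶜ (γ t) \ range γ) a,
        connectedComponentIn_subset _ _, mem_connectedComponentIn ha, ?_,
        isPreconnected_connectedComponentIn⟩
      rw [connectedComponentIn_connectedComponentIn_diff ha, ← hd, h a ha b hb, hd,
        ← connectedComponentIn_connectedComponentIn_diff hb]
      exact mem_connectedComponentIn hb
    refine encard_eq_two.2 ⟨_, _, hab, Subset.antisymm ?_ ?_⟩
    · rintro _ ⟨c, hc, rfl⟩
      rw [connectedComponentIn_connectedComponentIn_diff hc, ← hd]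
      rcases connectedComponentIn_compl_union_arc_eq_or hH hγ hi hinter
        isPreconnected_connectedComponentIn hdisj ha.1 hb.1 hc.1 ha.2 hb.2 hc.2 with h | h | h
      · exact absurd h hab
      · exact .inl h.symm
      · exact .inr h.symm
    · rintro _ (rfl | rfl)
      · exact ⟨a, ha, by rw [connectedComponentIn_connectedComponentIn_diff ha, ← hd]⟩
      · exact ⟨b, hb, by rw [connectedComponentIn_connectedComponentIn_diff hb, ← hd]⟩
  have := encard_componentsIn_diff (hIoo t ht) hsub
  rw [hD, ← hd, ← one_add_one_eq_two, ← add_assoc] at this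
  exact WithTop.add_right_cancel ENat.one_ne_top this

end attach

/-! ### Euler's formula in the plane. -/

section euler

variable {V E : Type*} {G : ColoredGraph V E} {p : V → ℂ} {γ : E → I → ℂ}

/-- The union of the vertices in `S` and of the edges in `T` of a graph drawn in the plane. -/
def planeSupport (p : V → ℂ) (γ : E → I → ℂ) (S : Finset V) (T : Finset E) : Set ℂ :=
  p '' S ∪ ⋃ e ∈ T, range (γ e)

/-- A connected graph without loops drawn in the plane. -/
structure IsPlaneDrawing (G : ColoredGraph V E) (p : V → ℂ) (γ : E → I → ℂ) : Prop where
  injective_point : Function.Injective p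
  continuous_arc : ∀ e, Continuous (γ e)
  injective_arc : ∀ e, Function.Injective (γ e)
  arc_zero : ∀ e, γ e 0 = p (G.tips e).1
  arc_one : ∀ e, γ e 1 = p (G.tips e).2
  arc_ne_point : ∀ e, ∀ t ∈ Ioo (0 : I) 1, ∀ v, γ e t ≠ p v
  arc_disjoint : ∀ e e', e ≠ e' → Disjoint (γ e '' Ioo 0 1) (γ e' '' Ioo 0 1)

namespace IsPlaneDrawing

variable (h : IsPlaneDrawing G p γ) {S : Finset V} {T : Finset E}
  (hT : ∀ e ∈ T, (G.tips e).1 ∈ S ∧ (G.tips e).2 ∈ S)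

include h

theorem isCompact_planeSupport (S : Finset V) (T : Finset E) :
    IsCompact (planeSupport p γ S T) :=
  ((S.finite_toSet.image p).isCompact).union
    (T.finite_toSet.isCompact_biUnion fun e _ => isCompact_range (h.continuous_arc e))

theorem arc_notMem_planeSupport {e : E} (he : e ∉ T) {t : I} (ht : t ∈ Ioo 0 1) :
    γ e t ∉ planeSupport p γ S T := by
  rintro (⟨w, hw, hwv⟩ | hv)
  · exact h.arc_ne_point e t ht w hwv.symm
  · obtain ⟨e', he', hv⟩ := mem_iUnion₂.1 hv
    rw [range_arc_eq] at hv
    rcases hv with hv | hv | hv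
    · exact (h.arc_disjoint e e' fun h => he (h ▸ he')).ne_of_mem (mem_image_of_mem _ ht) hv rfl
    · exact h.arc_ne_point e t ht _ (hv.trans (h.arc_zero e'))
    · exact h.arc_ne_point e t ht _ (hv.trans (h.arc_one e'))

include hT

theorem point_mem_planeSupport_iff {v : V} : p v ∈ planeSupport p γ S T ↔ v ∈ S := by
  refine ⟨?_, fun hv => .inl ⟨v, hv, rfl⟩⟩
  rintro (⟨w, hw, hwv⟩ | hv)
  · exact h.injective_point hwv ▸ hw
  · obtain ⟨e, he, hv⟩ := mem_iUnion₂.1 hv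
    rw [range_arc_eq] at hv
    rcases hv with ⟨s, hs, hsv⟩ | hv | hv
    · exact absurd hsv (h.arc_ne_point e s hs v)
    · rw [h.arc_zero] at hv
      exact h.injective_point hv ▸ (hT e he).1
    · rw [mem_singleton_iff, h.arc_one] at hv
      exact h.injective_point hv ▸ (hT e he).2

end IsPlaneDrawing
end euler

namespace ColoredGraph

/-- In a connected graph some edge leaves any nonempty proper set of vertices. -/
theorem Connected.exists_edge_between {V E : Type*} {G : ColoredGraph V E} (h : G.Connected)
    {S : Set V} (hne : S.Nonempty) (hS : S ≠ univ) :
    ∃ e, ((G.tips e).1 ∈ S ∧ (G.tips e).2 ∉ S) ∨ ((G.tips e).1 ∉ S ∧ (G.tips e).2 ∈ S) := by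
  by_contra! hno
  obtain ⟨v, hv⟩ := hne
  refine hS (eq_univ_of_forall fun w => ?_)
  have hvw := (SimpleGraph.reachable_iff_reflTransGen _ _).1 (h.preconnected v w)
  induction hvw with
  | refl => exact hv
  | tail _ hadj ih =>
    rw [SimpleGraph.fromRel_adj] at hadj
    obtain ⟨-, ⟨e, he⟩ | ⟨e, he⟩⟩ := hadj
    · have := (hno e).1
      rw [he] at this
      exact this ih
    · by_contra hb
      have := (hno e).2
      rw [he] at this
      exact this hb ih

end ColoredGraph

namespace IsPlaneDrawing

variable {V E : Type*} {G : ColoredGraph V E} {p : V → ℂ} {γ : E → I → ℂ}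
  (h : IsPlaneDrawing G p γ) {S : Finset V} {T : Finset E}

theorem planeSupport_insert_edge [DecidableEq E] (e : E) :
    planeSupport p γ S (insert e T) = planeSupport p γ S T ∪ range (γ e) := by
  simp only [planeSupport, Finset.set_biUnion_insert]
  rw [union_comm (range (γ e)), union_assoc]

theorem planeSupport_insert_vertex [DecidableEq V] {v : V} (hv : p v ∈ planeSupport p γ S T) :
    planeSupport p γ (insert v S) T = planeSupport p γ S T := by
  rw [planeSupport, Finset.coe_insert, image_insert_eq, insert_union]
  exact insert_eq_of_mem hv

include h

/-- **Euler's formula** for graphs drawn in the plane: the version for subgraphs which are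
obtained by attaching edges one at a time. -/
theorem exists_subgraph_euler [Fintype V] [Fintype E] (hG : G.Connected) {n : ℕ}
    (hn : n ≤ Fintype.card E) : ∃ (S : Finset V) (T : Finset E),
      (∀ e ∈ T, (G.tips e).1 ∈ S ∧ (G.tips e).2 ∈ S) ∧ S.Nonempty ∧ T.card = n ∧
      IsPreconnected (planeSupport p γ S T) ∧
      (componentsIn (planeSupport p γ S T)ᶜ).encard + S.card = T.card + 2 := by
  classical
  induction n with
  | zero =>
    obtain ⟨v⟩ := hG.nonempty
    have hs : planeSupport p γ {v} ∅ = {p v} := by simp [planeSupport]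
    refine ⟨{v}, ∅, by simp, by simp, rfl, hs ▸ isPreconnected_singleton, ?_⟩
    have hc := isConnected_compl_singleton_of_one_lt_rank (E := ℂ) (by simp) (p v)
    rw [hs, componentsIn_encard_eq_one hc.isPreconnected hc.nonempty]
    simp [one_add_one_eq_two]
  | succ n ih =>
    obtain ⟨S, T, hT, hS, hcard, hconn, heuler⟩ := ih (by omega)
    have hK := h.isCompact_planeSupport S T
    by_cases hSu : (S : Set V) = univ
    -- All vertices are present: a new edge has both ends on the drawing and adds one edge and one
    -- face.
    · have hall : ∀ v, v ∈ S := fun v => Finset.mem_coe.1 (hSu ▸ mem_univ v)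
      obtain ⟨e, he⟩ : ∃ e, e ∉ T := by
        by_contra! hall
        have := Finset.card_eq_iff_eq_univ T |>.2 (Finset.eq_univ_iff_forall.2 hall)
        omega
      have hmem : ∀ v, p v ∈ planeSupport p γ S T := fun v =>
        .inl ⟨v, hall v, rfl⟩
      have h0 : γ e 0 ∈ planeSupport p γ S T := h.arc_zero e ▸ hmem _
      have h1 : γ e 1 ∈ planeSupport p γ S T := h.arc_one e ▸ hmem _
      refine ⟨S, insert e T, fun e' _ => ⟨hall _, hall _⟩, hS,
        by rw [Finset.card_insert_of_notMem he, hcard], ?_, ?_⟩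
      · rw [planeSupport_insert_edge]
        exact hconn.union _ h0 (mem_range_self 0) (isPreconnected_range (h.continuous_arc e))
      · rw [planeSupport_insert_edge, encard_componentsIn_compl_union_arc_add_one hK hconn
          (h.continuous_arc e) (h.injective_arc e) (fun t ht => h.arc_notMem_planeSupport he ht)
          h0 h1, add_right_comm, heuler, Finset.card_insert_of_notMem he]
        push_cast
        ring
    -- An edge leaving `S` meets the drawing only at its old tip: it adds one vertex, one edge and
    -- no face.
    · obtain ⟨e, he⟩ := hG.exists_edge_between (Finset.coe_nonempty.2 hS) hSu
      obtain ⟨v, hvS, hv, hu, hsub⟩ : ∃ v, v ∉ S ∧ p v ∈ range (γ e) ∧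
          (∃ z ∈ planeSupport p γ S T, z ∈ range (γ e)) ∧
          ((∀ e' ∈ insert e T, (G.tips e').1 ∈ insert v S ∧ (G.tips e').2 ∈ insert v S) ∧ e ∉ T ∧
            (planeSupport p γ S T ∩ range (γ e)).Subsingleton) := by
        have heT : e ∉ T := fun hc => by
          have := hT e hc
          simp only [Finset.mem_coe] at he
          tauto
        have hsub : ∀ z ∈ planeSupport p γ S T ∩ range (γ e), z = γ e 0 ∨ z = γ e 1 := by
          rintro z ⟨hz, hzγ⟩
          rw [range_arc_eq] at hzγ
          rcases hzγ with ⟨s, hs, rfl⟩ | hz'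
          · exact absurd hz (h.arc_notMem_planeSupport heT hs)
          · exact hz'
        have hins : ∀ v, ∀ e' ∈ T, (G.tips e').1 ∈ insert v S ∧ (G.tips e').2 ∈ insert v S :=
          fun v e' he' => ⟨Finset.mem_insert_of_mem (hT e' he').1,
            Finset.mem_insert_of_mem (hT e' he').2⟩
        rcases he with ⟨h1, h2⟩ | ⟨h1, h2⟩
        · refine ⟨(G.tips e).2, h2, ⟨1, h.arc_one e⟩,
            ⟨γ e 0, by rw [h.arc_zero]; exact .inl ⟨_, h1, rfl⟩, mem_range_self _⟩, ?_, heT, ?_⟩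
          · intro e' he'
            rcases Finset.mem_insert.1 he' with rfl | he'
            · exact ⟨Finset.mem_insert_of_mem h1, Finset.mem_insert_self _ _⟩
            · exact hins _ _ he'
          · have key : ∀ z ∈ planeSupport p γ S T ∩ range (γ e), z = γ e 0 := fun z hz =>
              (hsub z hz).resolve_right fun hz1 => h2 <| by
                rw [Finset.mem_coe, ← h.point_mem_planeSupport_iff hT, ← h.arc_one, ← hz1]
                exact hz.1
            exact fun z hz w hw => (key z hz).trans (key w hw).symm
        · refine ⟨(G.tips e).1, h1, ⟨0, h.arc_zero e⟩,
            ⟨γ e 1, by rw [h.arc_one]; exact .inl ⟨_, h2, rfl⟩, mem_range_self _⟩, ?_, heT, ?_⟩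
          · intro e' he'
            rcases Finset.mem_insert.1 he' with rfl | he'
            · exact ⟨Finset.mem_insert_self _ _, Finset.mem_insert_of_mem h2⟩
            · exact hins _ _ he'
          · have key : ∀ z ∈ planeSupport p γ S T ∩ range (γ e), z = γ e 1 := fun z hz =>
              (hsub z hz).resolve_left fun hz1 => h1 <| by
                rw [Finset.mem_coe, ← h.point_mem_planeSupport_iff hT, ← h.arc_zero, ← hz1]
                exact hz.1
            exact fun z hz w hw => (key z hz).trans (key w hw).symm
      obtain ⟨htips, heT, hss⟩ := hsub
      obtain ⟨z, hz, hzγ⟩ := hu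
      have hsupp : planeSupport p γ (insert v S) (insert e T) =
          planeSupport p γ S T ∪ range (γ e) := by
        rw [planeSupport_insert_vertex, planeSupport_insert_edge]
        rw [planeSupport_insert_edge]
        exact .inr hv
      refine ⟨insert v S, insert e T, htips, Finset.insert_nonempty _ _,
        by rw [Finset.card_insert_of_notMem heT, hcard], ?_, ?_⟩
      · rw [hsupp]
        exact hconn.union z hz hzγ (isPreconnected_range (h.continuous_arc e))
      · rw [hsupp, encard_componentsIn_compl_union_arc hK (h.continuous_arc e)
          (h.injective_arc e) (fun t ht => h.arc_notMem_planeSupport heT ht) hss,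
          Finset.card_insert_of_notMem heT, Finset.card_insert_of_notMem hvS]
        push_cast
        rw [← add_assoc, heuler]
        ring

/-- **Euler's formula** for graphs drawn in the plane. -/
theorem euler [Fintype V] [Fintype E] (hG : G.Connected) :
    (componentsIn (range p ∪ ⋃ e, range (γ e))ᶜ).encard + Fintype.card V = Fintype.card E + 2 := by
  obtain ⟨S, T, hT, hS, hcard, -, heuler⟩ := h.exists_subgraph_euler hG le_rfl
  obtain rfl := (Finset.card_eq_iff_eq_univ T).1 hcard
  obtain rfl : S = Finset.univ := by
    by_contra hSu
    obtain ⟨e, he⟩ := hG.exists_edge_between (Finset.coe_nonempty.2 hS)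
      (by simpa using hSu)
    have := hT e (Finset.mem_univ e)
    simp only [Finset.mem_coe] at he
    tauto
  simpa [planeSupport] using heuler

end IsPlaneDrawing

/-! ### Passage between the plane and the sphere. -/

theorem encard_image_le_encard_image {α β δ : Type*} {f : α → β} {g : α → δ} {s : Set α}
    (h : ∀ x ∈ s, ∀ y ∈ s, g x = g y → f x = f y) : (f '' s).encard ≤ (g '' s).encard := by
  rcases s.eq_empty_or_nonempty with rfl | ⟨a, ha⟩
  · simp
  have : Nonempty α := ⟨a⟩
  have heq : f '' s = (fun d => f (Function.invFunOn g s d)) '' (g '' s) := by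
    rw [image_image]
    refine image_congr fun x hx => h _ hx _ (Function.invFunOn_mem ⟨x, hx, rfl⟩) ?_
    exact (Function.invFunOn_eq ⟨x, hx, rfl⟩).symm
  rw [heq]
  exact encard_image_le _ _

namespace OnePoint

theorem isPreconnected_insert_infty {R : ℝ} (hR : 0 < R) :
    IsPreconnected (insert ∞ ((↑) '' {z : ℂ | R < ‖z‖}) : Set (OnePoint ℂ)) := by
  have h : IsPreconnected ((↑) '' {z : ℂ | R < ‖z‖} : Set (OnePoint ℂ)) :=
    (isPreconnected_setOf_lt_norm hR).image _ continuous_coe.continuousOn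
  refine h.subset_closure (subset_insert _ _) (insert_subset ?_ subset_closure)
  refine mem_closure_of_tendsto tendsto_coe_infty ?_
  rw [coclosedCompact_eq_cocompact]
  filter_upwards [tendsto_norm_cocompact_atTop.eventually_gt_atTop R] with z hz
  exact ⟨z, hz, rfl⟩

/-- If `∞ ∈ W`, the connected exterior region lies in one half of any separation of the preimage;
adding `∞` to that half keeps it open, and `W` itself would be separated. -/
theorem isPreconnected_preimage_coe {W : Set (OnePoint ℂ)} (hW : IsPreconnected W) {R : ℝ}
    (hR : 0 < R) (h : ∞ ∈ W → (↑) '' {z : ℂ | R < ‖z‖} ⊆ W) :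
    IsPreconnected ((↑) ⁻¹' W : Set ℂ) := by
  by_cases hi : ∞ ∈ W
  · have hA : {z : ℂ | R < ‖z‖} ⊆ (↑) ⁻¹' W := image_subset_iff.1 (h hi)
    have key : ∀ u v : Set ℂ, IsOpen u → IsOpen v → (↑) ⁻¹' W ⊆ u ∪ v → (↑) ⁻¹' W ∩ (u ∩ v) = ∅ →
        {z : ℂ | R < ‖z‖} ⊆ u → (↑) ⁻¹' W ⊆ u ∨ (↑) ⁻¹' W ⊆ v := by
      intro u v hu hv huv hd hAu
      have hpre : (↑) ⁻¹' (insert ∞ ((↑) '' u) : Set (OnePoint ℂ)) = u := by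
        ext z; simp
      have hu' : IsOpen (insert ∞ ((↑) '' u) : Set (OnePoint ℂ)) := by
        rw [isOpen_iff_of_mem' (mem_insert _ _), hpre]
        refine ⟨(isCompact_closedBall (0 : ℂ) R).of_isClosed_subset hu.isClosed_compl ?_, hu⟩
        intro z hz
        by_contra hzR
        exact hz (hAu (by simpa using hzR))
      have hv' : IsOpen ((↑) '' v : Set (OnePoint ℂ)) := isOpen_image_coe.2 hv
      have hcov : W ⊆ insert ∞ ((↑) '' u) ∪ (↑) '' v := by
        intro z hz
        induction z using OnePoint.rec with
        | infty => exact .inl (mem_insert _ _)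
        | coe z =>
          rcases huv hz with h | h
          · exact .inl (.inr ⟨z, h, rfl⟩)
          · exact .inr ⟨z, h, rfl⟩
      have hemp : W ∩ (insert ∞ ((↑) '' u) ∩ (↑) '' v) = ∅ := by
        refine eq_empty_of_forall_notMem ?_
        rintro _ ⟨hz, hzu, z, hzv, rfl⟩
        have : z ∈ u := hpre.subset hzu
        exact (hd.subset ⟨hz, this, hzv⟩ : z ∈ (∅ : Set ℂ))
      rcases isPreconnected_iff_subset_of_disjoint.1 hW _ _ hu' hv' hcov hemp with h1 | h1
      · exact .inl ((preimage_mono h1).trans hpre.subset)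
      · exact absurd (h1 hi) infty_notMem_image_coe
    rw [isPreconnected_iff_subset_of_disjoint]
    intro u v hu hv huv hd
    rcases isPreconnected_iff_subset_of_disjoint.1 (isPreconnected_setOf_lt_norm hR) u v hu hv
      (hA.trans huv) (subset_empty_iff.1 (hd ▸ inter_subset_inter_left _ hA)) with hAu | hAv
    · exact key u v hu hv huv hd hAu
    · exact (key v u hv hu (union_comm u v ▸ huv) (inter_comm u v ▸ hd) hAv).symm
  · rw [← isOpenEmbedding_coe.isInducing.isPreconnected_image, image_preimage_eq_of_subset]
    · exact hW
    · intro z hz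
      induction z using OnePoint.rec with
      | infty => exact absurd hz hi
      | coe z => exact mem_range_self z

/-- The complement of a compact plane set has as many components in the sphere as in the plane. -/
theorem encard_componentsIn_compl_image_coe {K : Set ℂ} (hK : IsCompact K) :
    (componentsIn ((↑) '' K : Set (OnePoint ℂ))ᶜ).encard = (componentsIn Kᶜ).encard := by
  set U : Set (OnePoint ℂ) := ((↑) '' K)ᶜ with hU
  obtain ⟨R, hR0, hR⟩ := hK.isBounded.exists_pos_norm_le
  have hmem : ∀ z : ℂ, (z : OnePoint ℂ) ∈ U ↔ z ∈ Kᶜ := fun z => by simp [hU]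
  have hiU : ∞ ∈ U := by simp [hU]
  have hAU : insert ∞ ((↑) '' {z : ℂ | R < ‖z‖}) ⊆ U := by
    rw [insert_subset_iff, image_subset_iff]
    exact ⟨hiU, fun z (hz : R < ‖z‖) => (hmem z).2 fun hzK => (hR z hzK).not_gt hz⟩
  have hinf : ∀ w, ∞ ∈ connectedComponentIn U w →
      (↑) '' {z : ℂ | R < ‖z‖} ⊆ connectedComponentIn U w := by
    intro w hw
    rw [connectedComponentIn_eq hw]
    exact (subset_insert _ _).trans
      ((isPreconnected_insert_infty hR0).subset_connectedComponentIn (mem_insert _ _) hAU)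
  have h1 : componentsIn U = (fun z : ℂ => connectedComponentIn U z) '' Kᶜ := by
    ext c
    constructor
    · rintro ⟨w, hw, rfl⟩
      induction w using OnePoint.rec with
      | coe w => exact ⟨w, (hmem w).1 hw, rfl⟩
      | infty =>
        -- Any finite point beyond radius `R` represents the component of `∞`; here it is `R + 1`.
        have hlt : R < ‖((R + 1 : ℝ) : ℂ)‖ := by
          rw [Complex.norm_real, Real.norm_of_nonneg (by positivity)]
          linarith
        have hz := hinf _ (mem_connectedComponentIn hiU) ⟨((R + 1 : ℝ) : ℂ), hlt, rfl⟩
        exact ⟨_, (hmem _).1 (connectedComponentIn_subset _ _ hz),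
          (connectedComponentIn_eq hz).symm⟩
    · rintro ⟨z, hz, rfl⟩
      exact ⟨z, (hmem z).2 hz, rfl⟩
  have h2 : componentsIn Kᶜ = connectedComponentIn Kᶜ '' Kᶜ := by
    ext c
    exact ⟨fun ⟨z, hz, e⟩ => ⟨z, hz, e.symm⟩, fun ⟨z, hz, e⟩ => ⟨z, hz, e.symm⟩⟩
  rw [h1, h2]
  refine le_antisymm (encard_image_le_encard_image fun x hx y hy h => ?_)
    (encard_image_le_encard_image fun x hx y hy h => ?_)
  rotate_left
  · have hpre := isPreconnected_preimage_coe
      (isPreconnected_connectedComponentIn (F := U) (x := (x : OnePoint ℂ))) hR0 (hinf _)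
    have hsub := hpre.subset_connectedComponentIn (x := x) (F := Kᶜ)
      (mem_connectedComponentIn ((hmem x).2 hx))
      fun z hz => (hmem z).1 (connectedComponentIn_subset _ _ hz)
    refine connectedComponentIn_eq (hsub ?_)
    change (y : OnePoint ℂ) ∈ connectedComponentIn U x
    rw [h]
    exact mem_connectedComponentIn ((hmem y).2 hy)
  · refine connectedComponentIn_eq (y := (y : OnePoint ℂ)) ?_
    have himg : IsPreconnected ((↑) '' connectedComponentIn Kᶜ x : Set (OnePoint ℂ)) :=
      isPreconnected_connectedComponentIn.image _ continuous_coe.continuousOn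
    refine himg.subset_connectedComponentIn ⟨x, mem_connectedComponentIn hx, rfl⟩ ?_
      ⟨y, h ▸ mem_connectedComponentIn hy, rfl⟩
    rintro _ ⟨z, hz, rfl⟩
    exact (hmem z).2 (connectedComponentIn_subset _ _ hz)

/-- The homeomorphisms of the sphere act transitively. -/
theorem exists_homeomorph_infty_eq (x : OnePoint ℂ) :
    ∃ φ : OnePoint ℂ ≃ₜ OnePoint ℂ, φ ∞ = x := by
  let e : OnePoint ℂ ≃ₜ Metric.sphere (0 : EuclideanSpace ℝ (Fin 3)) 1 :=
    onePointEquivSphereOfFinrankEq (by simp)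
  have hv : ‖(e x : EuclideanSpace ℝ (Fin 3))‖ = 1 := by simp
  have hv0 : (e x : EuclideanSpace ℝ (Fin 3)) ≠ 0 := fun h => by simp [h] at hv
  have : Fact (Module.finrank ℝ (EuclideanSpace ℝ (Fin 3)) = 2 + 1) := ⟨by simp⟩
  obtain ⟨l⟩ := FiniteDimensional.nonempty_continuousLinearEquiv_of_finrank_eq
    (𝕜 := ℝ) (E := ℂ) (F := (Submodule.span ℝ {(e x : EuclideanSpace ℝ (Fin 3))})ᗮ) (by
      rw [Submodule.finrank_orthogonal_span_singleton (n := 2) hv0, Complex.finrank_real_complex])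
  -- Stereographic projection from the pole `e x`, after identifying `ℂ` with the plane orthogonal
  -- to it, sends `∞` to that pole.
  refine ⟨l.toHomeomorph.onePointCongr.trans
    ((onePointHyperplaneHomeoUnitSphere hv).trans e.symm), ?_⟩
  change e.symm (onePointHyperplaneHomeoUnitSphere hv ∞) = x
  rw [Homeomorph.symm_apply_eq]
  rfl

end OnePoint

theorem Homeomorph.encard_componentsIn_image {X Y : Type*} [TopologicalSpace X]
    [TopologicalSpace Y] (φ : X ≃ₜ Y) (U : Set X) :
    (componentsIn (φ '' U)).encard = (componentsIn U).encard := by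
  have h : componentsIn (φ '' U) = Set.image φ '' componentsIn U := by
    ext c
    constructor
    · rintro ⟨_, ⟨x, hx, rfl⟩, rfl⟩
      exact ⟨_, ⟨x, hx, rfl⟩, φ.image_connectedComponentIn hx⟩
    · rintro ⟨_, ⟨x, hx, rfl⟩, rfl⟩
      exact ⟨φ x, ⟨x, hx, rfl⟩, φ.image_connectedComponentIn hx⟩
  rw [h, φ.injective.image_injective.encard_image]

/-! ### Euler's formula on the sphere. -/

namespace SphereGraph

variable {V E : Type*} (G : SphereGraph V E)

theorem injective_arc (h : ∀ e, (G.tips e).1 ≠ (G.tips e).2) (e : E) :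
    Function.Injective (G.arc e) := by
  have h01 : G.arc e 0 ≠ G.arc e 1 := by
    rw [G.arc_zero, G.arc_one]
    exact G.point_injective.ne (h e)
  have key : ∀ t ∈ Ioo (0 : I) 1, G.arc e t ≠ G.arc e 0 ∧ G.arc e t ≠ G.arc e 1 := fun t ht =>
    ⟨G.arc_zero e ▸ G.arc_ne_point e t ht _, G.arc_one e ▸ G.arc_ne_point e t ht _⟩
  have cases : ∀ t : I, t = 0 ∨ t = 1 ∨ t ∈ Ioo (0 : I) 1 := fun t => by
    rcases eq_or_lt_of_le t.2.1 with h | h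
    · exact .inl (Subtype.ext h.symm)
    rcases eq_or_lt_of_le t.2.2 with h' | h'
    · exact .inr (.inl (Subtype.ext h'))
    · exact .inr (.inr ⟨h, h'⟩)
  intro s t hst
  rcases cases s with rfl | rfl | hs <;> rcases cases t with rfl | rfl | ht
  · rfl
  · exact absurd hst h01
  · exact absurd hst.symm (key t ht).1
  · exact absurd hst.symm h01
  · rfl
  · exact absurd hst.symm (key t ht).2
  · exact absurd hst (key s hs).1
  · exact absurd hst (key s hs).2
  · exact G.arc_injOn e hs ht hst

/-- By Baire, one of finitely many closed sets covering the sphere has interior points, but neither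
a point nor an arc does. -/
theorem support_ne_univ [Finite V] [Finite E] (h : ∀ e, (G.tips e).1 ≠ (G.tips e).2) :
    G.support ≠ univ := by
  intro hu
  have hcl : ∀ i : V ⊕ E, IsClosed (Sum.elim (fun v => {G.point v}) (fun e => range (G.arc e)) i) :=
    Sum.rec (fun v => isClosed_singleton)
      (fun e => (isCompact_range (G.arc e).continuous).isClosed)
  obtain ⟨v | e, hi⟩ := nonempty_interior_of_iUnion_of_closed hcl (by
    rw [← hu, support, iUnion_sum, ← iUnion_singleton_eq_range]; rfl)
  · simp [interior_singleton] at hi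
  · refine not_image_subset_range_arc
      ((G.arc e).continuous.isClosedEmbedding (G.injective_arc h e)).isEmbedding
      OnePoint.continuous_coe OnePoint.coe_injective
      (isOpen_interior.preimage OnePoint.continuous_coe)
      (O := (↑) ⁻¹' interior (range (G.arc e))) ?_
      ((image_preimage_subset _ _).trans interior_subset)
    obtain ⟨z, hz⟩ := OnePoint.denseRange_coe.exists_mem_open isOpen_interior hi
    exact ⟨z, hz⟩

/-- **Euler's formula** for connected graphs without loops embedded in the sphere. -/
theorem encard_faces_add_card [Fintype V] [Fintype E] (hG : G.IsPlanarMap)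
    (h : ∀ e, (G.tips e).1 ≠ (G.tips e).2) :
    G.faces.encard + Fintype.card V = Fintype.card E + 2 := by
  obtain ⟨x₀, hx₀⟩ := (ne_univ_iff_exists_notMem _).1 (G.support_ne_univ h)
  obtain ⟨φ, hφ⟩ := OnePoint.exists_homeomorph_infty_eq x₀
  have hlift : ∀ y ∈ G.support, ∃ z : ℂ, φ z = y := by
    intro y hy
    obtain ⟨w, rfl⟩ := φ.surjective y
    induction w using OnePoint.rec with
    | infty => exact absurd (hφ ▸ hy) hx₀
    | coe w => exact ⟨w, rfl⟩
  choose p hp using fun v => hlift (G.point v) (.inl ⟨v, rfl⟩)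
  choose γ hγ using fun e t => hlift (G.arc e t) (.inr (mem_iUnion.2 ⟨e, t, rfl⟩))
  have hinj : Function.Injective fun z : ℂ => φ z := φ.injective.comp OnePoint.coe_injective
  have hemb : IsEmbedding fun z : ℂ => φ z :=
    φ.isEmbedding.comp OnePoint.isOpenEmbedding_coe.isEmbedding
  have hdraw : IsPlaneDrawing G.toColoredGraph p γ := by
    refine ⟨fun v w hvw => G.point_injective ?_, fun e => hemb.continuous_iff.2 ?_,
      fun e s t hst => G.injective_arc h e ?_, fun e => hinj ?_, fun e => hinj ?_,
      fun e t ht v hv => G.arc_ne_point e t ht v ?_, fun e e' hne => ?_⟩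
    · rw [← hp, ← hp, hvw]
    · exact (G.arc e).continuous.congr fun t => (hγ e t).symm
    · rw [← hγ, ← hγ, hst]
    · simp only [hγ, hp, G.arc_zero]
    · simp only [hγ, hp, G.arc_one]
    · rw [← hγ, ← hp, hv]
    · rw [disjoint_left]
      rintro _ ⟨s, hs, rfl⟩ ⟨t, ht, hst⟩
      refine (G.arc_disjoint e e' hne).ne_of_mem ⟨s, hs, rfl⟩ ⟨t, ht, rfl⟩ ?_
      rw [← hγ, ← hγ, hst]
  have hsupp : G.support = φ '' ((↑) '' (range p ∪ ⋃ e, range (γ e))) := by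
    rw [image_image, image_union, image_iUnion, ← range_comp]
    simp only [← range_comp]
    rw [support]
    congr 2
    · exact funext fun v => (hp v).symm
    · funext e
      congr 1
      exact funext fun t => (hγ e t).symm
  have hK : IsCompact (range p ∪ ⋃ e, range (γ e)) :=
    (finite_range p).isCompact.union
      (isCompact_iUnion fun e => isCompact_range (hdraw.continuous_arc e))
  have hfaces : G.faces = componentsIn G.supportᶜ := rfl
  rw [hfaces, hsupp, ← φ.image_compl, φ.encard_componentsIn_image,
    OnePoint.encard_componentsIn_compl_image_coe hK]
  exact hdraw.euler hG

end SphereGraph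

/-! ### Degree sums and isomorphisms of coloured graphs. -/

namespace ColoredGraph

variable {V E V' E' : Type*} {G : ColoredGraph V E} {G' : ColoredGraph V' E'}

theorem IsProperlyColored.tips_ne (h : G.IsProperlyColored) (e : E) :
    (G.tips e).1 ≠ (G.tips e).2 := fun he => by
  have := h e
  rw [he] at this
  tauto

theorem card_blackVertices_add_card_whiteVertices [Fintype V] (G : ColoredGraph V E) :
    G.blackVertices.card + G.whiteVertices.card = Fintype.card V := by
  classical
  exact Finset.card_filter_add_card_filter_not _

/-- Every edge of a properly coloured graph has exactly one white tip. -/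
theorem IsProperlyColored.sum_degree_whiteVertices [Fintype V] [Fintype E]
    (h : G.IsProperlyColored) : ∑ w ∈ G.whiteVertices, G.degree w = Fintype.card E := by
  classical
  have key : ∀ f : E → V, ∑ w ∈ G.whiteVertices, Finset.card {e : E | f e = w} =
      Finset.card {e : E | ¬ G.IsBlack (f e)} := by
    intro f
    rw [Finset.card_eq_sum_card_fiberwise (f := f) (t := G.whiteVertices)]
    · refine Finset.sum_congr rfl fun w hw => congrArg _ ?_
      ext e
      simp only [whiteVertices, Finset.mem_filter, Finset.mem_univ, true_and] at hw ⊢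
      exact ⟨fun he => ⟨he ▸ hw, he⟩, fun he => he.2⟩
    · intro e he
      simpa [whiteVertices] using he
  simp only [degree, Finset.sum_add_distrib]
  rw [key fun e => (G.tips e).1, key fun e => (G.tips e).2]
  -- Edges with a white first tip and edges with a white second tip are complementary families.
  have : ∀ e, ¬ G.IsBlack (G.tips e).2 ↔ G.IsBlack (G.tips e).1 := fun e => (h e).symm
  simp only [this]
  rw [add_comm]
  exact Finset.card_filter_add_card_filter_not _

theorem IsProperlyColored.sum_degree_sub_one [Fintype V] [Fintype E] (h : G.IsProperlyColored) :
    ∑ w ∈ G.whiteVertices, ((G.degree w : ℤ) - 1) =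
      Fintype.card E - Fintype.card V + G.blackVertices.card := by
  rw [Finset.sum_sub_distrib, ← Nat.cast_sum, h.sum_degree_whiteVertices,
    ← G.card_blackVertices_add_card_whiteVertices]
  simp only [Finset.sum_const, nsmul_eq_mul, mul_one]
  push_cast
  ring

/-- The inverse of an isomorphism. -/
def Iso.symm (φ : G.Iso G') : G'.Iso G where
  onVertices := φ.onVertices.symm
  onEdges := φ.onEdges.symm
  tips_eq e := by
    have h := φ.tips_eq (φ.onEdges.symm e)
    rw [Equiv.apply_symm_apply] at h
    have := congrArg (Sym2.map φ.onVertices.symm) h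
    simpa using this.symm
  isBlack_iff v := by
    rw [← φ.isBlack_iff, Equiv.apply_symm_apply]

theorem Iso.card_blackVertices_eq [Fintype V] [Fintype V'] (φ : G.Iso G') :
    G'.blackVertices.card = G.blackVertices.card := by
  classical
  refine (Finset.card_equiv φ.onVertices fun v => ?_).symm
  simp [blackVertices, φ.isBlack_iff]

theorem fromRel_adj_iff (G : ColoredGraph V E) (u v : V) :
    (SimpleGraph.fromRel fun u v : V => ∃ e, G.tips e = (u, v)).Adj u v ↔
      u ≠ v ∧ ∃ e, s((G.tips e).1, (G.tips e).2) = s(u, v) := by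
  simp only [SimpleGraph.fromRel_adj, Sym2.eq_iff, Prod.ext_iff]
  refine and_congr_right fun _ => ⟨?_, ?_⟩
  · rintro (⟨e, h⟩ | ⟨e, h⟩)
    exacts [⟨e, .inl h⟩, ⟨e, .inr h⟩]
  · rintro ⟨e, h | h⟩
    exacts [.inl ⟨e, h⟩, .inr ⟨e, h⟩]

theorem Iso.connected (φ : G.Iso G') (h : G.Connected) : G'.Connected := by
  refine (SimpleGraph.Iso.connected_iff ⟨φ.onVertices, @fun u v => ?_⟩).1 h
  rw [fromRel_adj_iff, fromRel_adj_iff, φ.onVertices.injective.ne_iff]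
  refine and_congr_right fun _ => ?_
  rw [← φ.onEdges.exists_congr_right]
  refine exists_congr fun e => ?_
  rw [φ.tips_eq, ← Sym2.map_mk, ← Sym2.map_mk,
    (Sym2.map.injective φ.onVertices.injective).eq_iff]

end ColoredGraph

/-! ### Balance as a property of the underlying graph. -/

namespace SphereGraph

variable {V E V' E' : Type*} {G : SphereGraph V E} {G' : SphereGraph V' E'}

theorem exists_encard_faces_eq [Fintype V] [Fintype E] (hG : G.IsPlanarMap)
    (h : G.toColoredGraph.IsProperlyColored) :
    ∃ f : ℕ, G.faces.encard = f ∧ f + Fintype.card V = Fintype.card E + 2 := by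
  have heuler := G.encard_faces_add_card hG h.tips_ne
  have hfin : G.faces.encard ≠ ⊤ := fun htop => by
    rw [htop, top_add] at heuler
    exact ENat.natCast_ne_top (Fintype.card E + 2) (by simpa using heuler.symm)
  obtain ⟨f, hf⟩ := ENat.ne_top_iff_exists.1 hfin
  refine ⟨f, hf.symm, ?_⟩
  rw [← hf] at heuler
  exact_mod_cast heuler

theorem Submap.isProperlyColored (h : G.toColoredGraph.IsProperlyColored) (H : G.Submap) :
    H.toSphereGraph.toColoredGraph.IsProperlyColored := fun e => h e

/-- Isomorphic embedded graphs have equally many faces. -/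
theorem encard_faces_eq_of_iso [Fintype V] [Fintype E] [Fintype V'] [Fintype E']
    (hG : G.IsPlanarMap) (h : G.toColoredGraph.IsProperlyColored) (hG' : G'.IsPlanarMap)
    (h' : G'.toColoredGraph.IsProperlyColored) (φ : G.toColoredGraph.Iso G'.toColoredGraph) :
    G.faces.encard = G'.faces.encard := by
  obtain ⟨f, hf, hfe⟩ := exists_encard_faces_eq hG h
  obtain ⟨f', hf', hfe'⟩ := exists_encard_faces_eq hG' h'
  have h1 := Fintype.card_congr φ.onVertices
  have h2 := Fintype.card_congr φ.onEdges
  rw [hf, hf']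
  congr 1
  omega

theorem isGloballyBalanced_iff_of_iso [Fintype V] [Fintype E] [Fintype V'] [Fintype E']
    (hG : G.IsBipartiteMap) (hG' : G'.IsBipartiteMap)
    (φ : G.toColoredGraph.Iso G'.toColoredGraph) :
    G.IsGloballyBalanced ↔ G'.IsGloballyBalanced := by
  rw [IsGloballyBalanced, IsGloballyBalanced, φ.card_blackVertices_eq,
    encard_faces_eq_of_iso hG.1 hG.2.2 hG'.1 hG'.2.2 φ]

/-- An isomorphism restricts to the graphs obtained by erasing corresponding vertices and edges. -/
def eraseIso (φ : G.toColoredGraph.Iso G'.toColoredGraph) {S : Finset V} {T : Finset E}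
    {S' : Finset V'} {T' : Finset E'} (hS : ∀ v, v ∈ S ↔ φ.onVertices v ∈ S')
    (hT : ∀ e, e ∈ T ↔ φ.onEdges e ∈ T') (h : ∀ e ∈ T, (G.tips e).1 ∈ S ∧ (G.tips e).2 ∈ S)
    (h' : ∀ e ∈ T', (G'.tips e).1 ∈ S' ∧ (G'.tips e).2 ∈ S') :
    (G.erase S T h).toColoredGraph.Iso (G'.erase S' T' h').toColoredGraph where
  onVertices := φ.onVertices.subtypeEquiv hS
  onEdges := φ.onEdges.subtypeEquiv hT
  tips_eq e := Sym2.map.injective Subtype.val_injective (φ.tips_eq e)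
  isBlack_iff v := φ.isBlack_iff v

/-- Each submap of `G'` pulls back to an isomorphic submap of `G`, which has as many faces by
Euler's formula. -/
theorem IsLocallyBalanced.of_iso [Fintype V] [Fintype E] [Fintype V'] [Fintype E']
    (hG : G.IsBipartiteMap) (hG' : G'.IsBipartiteMap)
    (φ : G.toColoredGraph.Iso G'.toColoredGraph) (h : G.IsLocallyBalanced) :
    G'.IsLocallyBalanced := by
  rintro H' ⟨v, hv, hvb⟩
  have hS : ∀ v, v ∈ H'.verts.map φ.onVertices.symm.toEmbedding ↔ φ.onVertices v ∈ H'.verts := by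
    simp [Finset.mem_map_equiv]
  have hT : ∀ e, e ∈ H'.edges.map φ.onEdges.symm.toEmbedding ↔ φ.onEdges e ∈ H'.edges := by
    simp [Finset.mem_map_equiv]
  have htips : ∀ e ∈ H'.edges.map φ.onEdges.symm.toEmbedding,
      (G.tips e).1 ∈ H'.verts.map φ.onVertices.symm.toEmbedding ∧
        (G.tips e).2 ∈ H'.verts.map φ.onVertices.symm.toEmbedding := by
    intro e he
    rw [hS, hS]
    have h1 := H'.tips_mem _ ((hT e).1 he)
    rcases Sym2.eq_iff.1 (φ.tips_eq e) with ⟨ha, hb⟩ | ⟨ha, hb⟩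
    · rwa [← ha, ← hb]
    · rw [← ha, ← hb]
      exact h1.symm
  have ψ := eraseIso φ hS hT htips H'.tips_mem
  let H : G.Submap := ⟨_, _, htips, ψ.symm.connected H'.isPlanarMap⟩
  have hH := h H ⟨φ.onVertices.symm v, (hS _).2 (by simpa using hv), by
    rwa [← φ.isBlack_iff, Equiv.apply_symm_apply]⟩
  have ψ' : H.toSphereGraph.toColoredGraph.Iso H'.toSphereGraph.toColoredGraph := ψ
  rw [encard_faces_eq_of_iso (G := H.toSphereGraph) (G' := H'.toSphereGraph) H.isPlanarMap
    (H.isProperlyColored hG.2.2) H'.isPlanarMap (H'.isProperlyColored hG'.2.2) ψ',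
    ← ψ'.card_blackVertices_eq] at hH
  exact hH

end SphereGraph

theorem mainTheorem4 {V E : Type*} [Fintype V] [Fintype E] (G : SphereGraph V E)
    (hG : G.IsBipartiteMap) :
    (G.IsGloballyBalanced ↔
      ∑ w ∈ G.whiteVertices, ((G.degree w : ℤ) - 1) = 2 * (G.blackVertices.card : ℤ) - 2) ∧
    (G.IsLocallyBalanced ↔
      ∀ H : G.Submap, (∃ v ∈ H.verts, G.IsBlack v) →
        ∑ w ∈ H.toSphereGraph.whiteVertices, ((H.toSphereGraph.degree w : ℤ) - 1) ≤
          2 * (H.toSphereGraph.blackVertices.card : ℤ) - 2) ∧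
    (∀ {V' E' : Type*} [Fintype V'] [Fintype E'] (G' : SphereGraph V' E'),
      G'.IsBipartiteMap → Nonempty (G.toColoredGraph.Iso G'.toColoredGraph) →
        (G.IsGloballyBalanced ↔ G'.IsGloballyBalanced) ∧
        (G.IsLocallyBalanced ↔ G'.IsLocallyBalanced) ∧
        (G.IsBalanced ↔ G'.IsBalanced)) := by
  refine ⟨?_, ?_, ?_⟩
  · obtain ⟨f, hf, hfe⟩ := SphereGraph.exists_encard_faces_eq hG.1 hG.2.2
    rw [hG.2.2.sum_degree_sub_one, SphereGraph.IsGloballyBalanced, hf, Nat.cast_inj]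
    -- With `f + V = E + 2`, the sum `E - V + B` is `f - 2 + B`.
    omega
  · refine forall_congr' fun H => imp_congr_right fun _ => ?_
    obtain ⟨f, hf, hfe⟩ := SphereGraph.exists_encard_faces_eq (G := H.toSphereGraph)
      H.isPlanarMap (H.isProperlyColored hG.2.2)
    rw [(H.isProperlyColored hG.2.2).sum_degree_sub_one, hf, Nat.cast_le]
    omega
  · rintro V' E' _ _ G' hG' ⟨φ⟩
    have hglob := SphereGraph.isGloballyBalanced_iff_of_iso hG hG' φ
    have hloc : G.IsLocallyBalanced ↔ G'.IsLocallyBalanced :=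
      ⟨SphereGraph.IsLocallyBalanced.of_iso hG hG' φ,
        SphereGraph.IsLocallyBalanced.of_iso hG' hG φ.symm⟩
    exact ⟨hglob, hloc, and_congr hglob hloc⟩
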